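/- Let $n\ge 2$ and let $\gamma_n$ be the standard Gaussian measure on $\mathbb{R}^n$. A partition of $\mathbb{R}^n$ is a family of measurable sets $B_1,\dots,B_{n+1}$ with union $\mathbb{R}^n$ and $\gamma_n(B_i\cap B_j)=0$ for $i\ne j$; its volumes are $(\gamma_n(B_1),\dots,\gamma_n(B_{n+1}))$. For $-1<\rho<1$ its noise stability is $$S_\rho(\{B_i\})=\sum_{i=1}^{n+1}\int_{\mathbb{R}^n}1_{B_i}\,T_\rho 1_{B_i}\,d\gamma_n,\qquad T_\rho f(x)=\int_{\mathbb{R}^n} f\big(\rho x+\sqrt{1-\rho^2}\,z\big)\,d\gamma_n(z).$$ A partition $\{A_i\}_{i=1}^{n+1}$ is flat if there are $y\in\mathbb{R}^n$ and nonzero vectors $y_1,\dots,y_{n+1}\in\mathbb{R}^n$, none of them a positive multiple of another one, such that $A_i=y+\{x:\langle x,y_i\rangle=\max_j\langle x,y_j\rangle\}$ for all $i$ (centered if $y=0$, shifted if $y\neq 0$). **Theorem.** Let $\{A_i\}_{i=1}^{n+1}$ be a flat partition of $\mathbb{R}^n$, shifted or centered, with volumes $a=(a_1,\dots,a_{n+1})$,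 where $a_i>0$ for every $i$ and $a\neq\left(\frac1{n+1},\dots,\frac1{n+1}\right)$. Then for every $0<\rho<1$, $$S_\rho(\{A_i\}_{i=1}^{n+1})<\sup S_\rho(\{B_i\}_{i=1}^{n+1}),$$ and for every $-1<\rho<0$, $$S_\rho(\{A_i\}_{i=1}^{n+1})>\inf S_\rho(\{B_i\}_{i=1}^{n+1}),$$ where the supremum and the infimum are over all partitions $\{B_i\}_{i=1}^{n+1}$ of $\mathbb{R}^n$ with volumes $a$. -/

import Mathlib

open MeasureTheory ProbabilityTheory

noncomputable section

/-- The Ornstein-Uhlenbeck (noise) operator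
`T_ρ f (x) = ∫ f (ρ x + √(1 - ρ²) y) dγ_n(y)` on `ℝⁿ`, with `γ_n` the standard Gaussian measure. -/
def noiseOperator {n : ℕ} (ρ : ℝ) (f : EuclideanSpace ℝ (Fin n) → ℝ)
    (x : EuclideanSpace ℝ (Fin n)) : ℝ :=
  ∫ y, f (ρ • x + Real.sqrt (1 - ρ ^ 2) • y) ∂(stdGaussian (EuclideanSpace ℝ (Fin n)))

/-- A partition of `ℝⁿ` into `k` measurable sets, up to Gaussian-null overlaps. -/
structure IsGaussianPartition {n k : ℕ} (A : Fin k → Set (EuclideanSpace ℝ (Fin n))) : Prop where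
  measurableSet : ∀ i, MeasurableSet (A i)
  iUnion_eq : ⋃ i, A i = Set.univ
  null_inter : ∀ i j, i ≠ j → stdGaussian (EuclideanSpace ℝ (Fin n)) (A i ∩ A j) = 0

/-- The sets `A₁, …, A_k` have Gaussian volumes `a₁, …, a_k`. -/
def HasVolumes {n k : ℕ} (A : Fin k → Set (EuclideanSpace ℝ (Fin n))) (a : Fin k → ℝ) : Prop :=
  ∀ i, (stdGaussian (EuclideanSpace ℝ (Fin n))).real (A i) = a i

/-- `A` is a flat partition with apex `y`: there are nonzero vectors `v₁, …, v_k`, none of which is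
a positive multiple of another one, with `A i = y + {x | ⟨x, v i⟩ = max_j ⟨x, v j⟩}`.
The partition is centered if `y = 0` and shifted if `y ≠ 0`. -/
structure IsFlatPartition {n k : ℕ} (y : EuclideanSpace ℝ (Fin n))
    (A : Fin k → Set (EuclideanSpace ℝ (Fin n))) : Prop where
  isGaussianPartition : IsGaussianPartition A
  exists_vectors : ∃ v : Fin k → EuclideanSpace ℝ (Fin n),
    (∀ i, v i ≠ 0) ∧
    (∀ i j, i ≠ j → ∀ c : ℝ, 0 < c → v i ≠ c • v j) ∧
    (∀ i, A i = (fun x => y + x) '' {x | ∀ j, inner ℝ x (v j) ≤ inner ℝ x (v i)})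

/-- The Gaussian noise stability `S_ρ(A) = ∑ i, ∫ 1_{A i} · T_ρ 1_{A i} dγ_n`. -/
def noiseStability {n k : ℕ} (ρ : ℝ) (A : Fin k → Set (EuclideanSpace ℝ (Fin n))) : ℝ :=
  ∑ i, ∫ x, (A i).indicator (fun _ => (1 : ℝ)) x *
    noiseOperator ρ ((A i).indicator (fun _ => (1 : ℝ))) x
      ∂(stdGaussian (EuclideanSpace ℝ (Fin n)))

/-- All values of `S_ρ` on partitions of `ℝⁿ` with the prescribed volumes `a`. -/
def stabilityValues {n k : ℕ} (ρ : ℝ) (a : Fin k → ℝ) : Set ℝ :=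
  {s | ∃ B : Fin k → Set (EuclideanSpace ℝ (Fin n)),
    IsGaussianPartition B ∧ HasVolumes B a ∧ s = noiseStability ρ B}

theorem noiseOperator_indicator_mem {n : ℕ} (ρ : ℝ) (A : Set (EuclideanSpace ℝ (Fin n)))
    (x : EuclideanSpace ℝ (Fin n)) :
    noiseOperator ρ (A.indicator (fun _ => (1 : ℝ))) x ∈ Set.Icc (0 : ℝ) 1 := by
  have h0 : ∀ z, 0 ≤ A.indicator (fun _ => (1 : ℝ)) z := fun z =>
    Set.indicator_nonneg (fun _ _ => zero_le_one) z
  have h1 : ∀ z, A.indicator (fun _ => (1 : ℝ)) z ≤ 1 := fun z =>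
    Set.indicator_le_self' (fun _ _ => zero_le_one) z
  refine ⟨integral_nonneg fun z => h0 _, ?_⟩
  have := integral_mono_of_nonneg (μ := stdGaussian (EuclideanSpace ℝ (Fin n)))
    (Filter.Eventually.of_forall fun y => h0 (ρ • x + Real.sqrt (1 - ρ ^ 2) • y))
    (integrable_const (1 : ℝ)) (Filter.Eventually.of_forall fun y => h1 _)
  simpa [noiseOperator] using this

theorem noiseStability_mem {n k : ℕ} (ρ : ℝ) (A : Fin k → Set (EuclideanSpace ℝ (Fin n))) :
    noiseStability ρ A ∈ Set.Icc (0 : ℝ) k := by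
  have h0 : ∀ i z, 0 ≤ (A i).indicator (fun _ => (1 : ℝ)) z := fun i z =>
    Set.indicator_nonneg (fun _ _ => zero_le_one) z
  have h1 : ∀ i z, (A i).indicator (fun _ => (1 : ℝ)) z ≤ 1 := fun i z =>
    Set.indicator_le_self' (fun _ _ => zero_le_one) z
  have hT := fun i => noiseOperator_indicator_mem ρ (A i)
  refine ⟨Finset.sum_nonneg fun i _ => integral_nonneg fun x => mul_nonneg (h0 i x) (hT i x).1, ?_⟩
  have key : ∀ i ∈ Finset.univ, ∫ x, (A i).indicator (fun _ => (1 : ℝ)) x *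
      noiseOperator ρ ((A i).indicator (fun _ => (1 : ℝ))) x
        ∂(stdGaussian (EuclideanSpace ℝ (Fin n))) ≤ 1 := by
    intro i _
    have := integral_mono_of_nonneg (μ := stdGaussian (EuclideanSpace ℝ (Fin n)))
      (Filter.Eventually.of_forall fun x => mul_nonneg (h0 i x) (hT i x).1)
      (integrable_const (1 : ℝ))
      (Filter.Eventually.of_forall fun x => mul_le_one₀ (h1 i x) (hT i x).1 (hT i x).2)
    simpa using this
  simpa [noiseStability] using Finset.sum_le_sum key

/-- The supremum and infimum of `stabilityValues` are those of a bounded set of reals. -/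
theorem stabilityValues_bounded {n k : ℕ} (ρ : ℝ) (a : Fin k → ℝ) :
    BddAbove (stabilityValues (n := n) ρ a) ∧ BddBelow (stabilityValues (n := n) ρ a) := by
  constructor
  · refine ⟨k, ?_⟩
    rintro s ⟨B, -, -, rfl⟩
    exact (noiseStability_mem ρ B).2
  · refine ⟨0, ?_⟩
    rintro s ⟨B, -, -, rfl⟩
    exact (noiseStability_mem ρ B).1

end

/-! Suppose the flat partition cannot be strictly improved in both directions. Exchanging small
pieces of equal measure between `A i` near a point `p` and `A j` near a point `q` changes the
stability, to first order, by a multiple of `F q - F p`, where `F = T_ρ (1_{A i} - 1_{A j})`. On the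
common boundary the roles of `p` and `q` can be interchanged, so both signs are available unless `F`
is constant there (`exists_lt_and_exists_gt_of_ne`). This stationarity condition does not see the
sign of `ρ`, which is why one argument gives both inequalities.

Now let `w` be a direction in which exactly `v i` and `v j` are maximal. The ray from the apex `y`
along `w` lies in `A i ∩ A j`, so `F` is constant on it. By the Cameron-Martin formula `F` is
real-analytic along lines, hence constant on the whole line. At the far end opposite to `w` the mass
of both cones disappears and the limit is 0. At the end towards `w` the two cones look like
complementary half-spaces, and the limit is the difference of the measures of these half-spaces.
Thus `F y = 0`, and the separating hyperplane of the half-spaces passes through the origin, that is,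
`⟨y, v i - v j⟩ = 0` (`noiseOperator_eq_and_integral_sign_eq_zero_of_edge`,
`integral_sign_inner_sub_ne_zero`).

Such pairs are the edges of the polytope spanned by the `v i`. Its graph is connected
(`exists_edge_of_strict_maximizers`), so `⟨y, v i⟩` is independent of `i`. The cones are then
invariant under translation by multiples of `y`, so `T_ρ 1_{A i}` at `y` is the volume of `A i`. The
identity `F y = 0` along edges, with connectedness again, makes all volumes equal, contrary to
assumption. -/

noncomputable section

/-! ### The standard Gaussian measure: Cameron-Martin formula, rotations, null hyperplanes, slicing.
-/

section GaussianFacts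

variable {E : Type*} [NormedAddCommGroup E] [InnerProductSpace ℝ E] [FiniteDimensional ℝ E]
  [MeasurableSpace E] [BorelSpace E]

-- In an orthonormal basis the integrand factors into one-dimensional complex exponentials. Mixing a
-- real and an imaginary exponent gives the characteristic function of an exponentially tilted
-- Gaussian, as the Cameron-Martin formula requires.
open Filter Topology Complex in
theorem integral_cexp_inner_stdGaussian (w t : E) :
    ∫ x, cexp ((inner ℝ x w : ℝ) + (inner ℝ x t : ℝ) * I) ∂(stdGaussian E) =
      cexp ((‖w‖ ^ 2 - ‖t‖ ^ 2) / 2 + (inner ℝ w t : ℝ) * I) := by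
  set b := stdOrthonormalBasis ℝ E with hb
  have h1 : ∀ x : Fin (Module.finrank ℝ E) → ℝ,
      cexp ((inner ℝ (∑ i, x i • b i) w : ℝ) + (inner ℝ (∑ i, x i • b i) t : ℝ) * I) =
        ∏ i, cexp (((inner ℝ (b i) w : ℝ) + (inner ℝ (b i) t : ℝ) * I) * x i) := by
    intro x
    rw [← Complex.exp_sum]
    congr 1
    simp only [sum_inner, real_inner_smul_left, ofReal_sum, ofReal_mul, Finset.sum_mul,
      ← Finset.sum_add_distrib]
    exact Finset.sum_congr rfl fun i _ => by ring
  rw [stdGaussian, integral_map (Measurable.aemeasurable (by fun_prop))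
    (Measurable.aestronglyMeasurable (by fun_prop))]
  simp_rw [← hb, h1]
  rw [integral_fintype_prod_eq_prod
    (f := fun i (x : ℝ) => cexp (((inner ℝ (b i) w : ℝ) + (inner ℝ (b i) t : ℝ) * I) * x))]
  have h2 : ∀ z : ℂ, ∫ x : ℝ, cexp (z * x) ∂(gaussianReal 0 1) = cexp (z ^ 2 / 2) := by
    intro z
    have := complexMGF_id_gaussianReal (μ := 0) (v := 1) z
    simpa [complexMGF] using this
  simp_rw [h2]
  rw [← Complex.exp_sum]
  congr 1
  have hw := b.sum_sq_inner_right w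
  have ht := b.sum_sq_inner_right t
  have hwt := b.sum_inner_mul_inner w t
  rw [← ofReal_pow, ← ofReal_pow, ← hw, ← ht, ← hwt]
  push_cast
  rw [← Finset.sum_sub_distrib, Finset.sum_div, Finset.sum_mul, ← Finset.sum_add_distrib]
  refine Finset.sum_congr rfl fun i _ => ?_
  rw [real_inner_comm w (b i)]
  linear_combination ((inner ℝ (b i) t : ℝ) : ℂ) ^ 2 / 2 * I_sq

theorem map_inner_stdGaussian (u : E) :
    ∃ m v, (stdGaussian E).map (fun x => inner ℝ x u) = gaussianReal m v ∧
      (u ≠ 0 → v ≠ 0) := by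
  have h := IsGaussian.map_eq_gaussianReal (μ := stdGaussian E) (innerSL ℝ u)
  refine ⟨(stdGaussian E)[innerSL ℝ u], Var[innerSL ℝ u; stdGaussian E].toNNReal, ?_, ?_⟩
  · rw [← h]
    congr 1
    ext x
    simp [real_inner_comm]
  · intro hu
    rw [variance_dual_stdGaussian]
    simpa using hu

theorem integrable_exp_inner_stdGaussian (u : E) (t : ℝ) :
    Integrable (fun x => Real.exp (t * inner ℝ x u)) (stdGaussian E) := by
  obtain ⟨m, v, h, -⟩ := map_inner_stdGaussian u
  have := integrable_exp_mul_gaussianReal (μ := m) (v := v) t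
  rw [← h] at this
  exact (integrable_map_measure (f := fun x : E => inner ℝ x u)
    (g := fun y : ℝ => Real.exp (t * y)) (by fun_prop) (by fun_prop)).1 this

theorem stdGaussian_hyperplane_eq_zero {u : E} (hu : u ≠ 0) (τ : ℝ) :
    stdGaussian E {x | inner ℝ x u = τ} = 0 := by
  obtain ⟨m, v, h, hv⟩ := map_inner_stdGaussian u
  have := nullSingletonClass_gaussianReal (μ := m) (hv hu)
  have h0 : gaussianReal m v {τ} = 0 := measure_singleton τ
  rw [← h, Measure.map_apply (by fun_prop) (measurableSet_singleton τ)] at h0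
  exact h0

/-- The measure is the image of a product of nondegenerate real Gaussians under a continuous
surjection. Positivity of a volume thereby reduces to finding one point of an open set. -/
instance isOpenPosMeasure_stdGaussian : (stdGaussian E).IsOpenPosMeasure := by
  have h1 : (gaussianReal 0 1).IsOpenPosMeasure :=
    (gaussianReal_absolutelyContinuous' 0 one_ne_zero).isOpenPosMeasure
  refine Continuous.isOpenPosMeasure_map (by fun_prop) ?_
  intro x
  refine ⟨fun i => inner ℝ (stdOrthonormalBasis ℝ E i) x, ?_⟩
  exact (stdOrthonormalBasis ℝ E).sum_repr' x

open Complex in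
/-- The Cameron-Martin formula for the standard Gaussian measure. -/
theorem stdGaussian_map_add_right (w : E) :
    (stdGaussian E).map (· + w) =
      (stdGaussian E).withDensity
        (fun x => ENNReal.ofReal (Real.exp (inner ℝ x w - ‖w‖ ^ 2 / 2))) := by
  have hint : Integrable (fun x => Real.exp (inner ℝ x w - ‖w‖ ^ 2 / 2)) (stdGaussian E) := by
    have := (integrable_exp_inner_stdGaussian w 1).mul_const (Real.exp (-(‖w‖ ^ 2 / 2)))
    refine this.congr (Filter.Eventually.of_forall fun x => ?_)
    simp only [one_mul, ← Real.exp_add, sub_eq_add_neg]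
  have := isFiniteMeasure_withDensity_ofReal hint.2
  refine Measure.ext_of_charFun (funext fun t => ?_)
  rw [charFun_map_add_const, charFun_stdGaussian, charFun_apply,
    integral_withDensity_eq_integral_toReal_smul (by fun_prop) (by simp)]
  have h1 : ∀ x : E, (ENNReal.ofReal (Real.exp (inner ℝ x w - ‖w‖ ^ 2 / 2))).toReal •
      cexp ((inner ℝ x t : ℝ) * I) =
      cexp (-(‖w‖ ^ 2 / 2)) * cexp ((inner ℝ x w : ℝ) + (inner ℝ x t : ℝ) * I) := by
    intro x
    rw [ENNReal.toReal_ofReal (Real.exp_pos _).le, Complex.real_smul, ofReal_exp,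
      ← Complex.exp_add, ← Complex.exp_add]
    push_cast
    ring_nf
  simp_rw [h1]
  rw [integral_const_mul, integral_cexp_inner_stdGaussian, ← Complex.exp_add, ← Complex.exp_add]
  ring_nf

theorem integral_add_right_stdGaussian (w : E) (h : E → ℝ) :
    ∫ x, h (x + w) ∂(stdGaussian E) =
      ∫ x, Real.exp (inner ℝ x w - ‖w‖ ^ 2 / 2) * h x ∂(stdGaussian E) := by
  have h1 := (measurableEmbedding_addRight w).integral_map (μ := stdGaussian E) h
  rw [← h1, stdGaussian_map_add_right,
    integral_withDensity_eq_integral_toReal_smul (by fun_prop) (by simp)]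
  simp [ENNReal.toReal_ofReal (Real.exp_pos _).le]

theorem stdGaussian_map_neg : (stdGaussian E).map (fun x => -x) = stdGaussian E :=
  stdGaussian_map (LinearIsometryEquiv.neg ℝ)

/-- The pairs `(X, Z)` and `(ρ X + σ Z, σ X - ρ Z)` have the same law under `γ ⊗ γ`. -/
theorem stdGaussian_prod_map_rotation {ρ σ : ℝ} (h : ρ ^ 2 + σ ^ 2 = 1) :
    ((stdGaussian E).prod (stdGaussian E)).map
      (fun p => (ρ • p.1 + σ • p.2, σ • p.1 - ρ • p.2)) =
      (stdGaussian E).prod (stdGaussian E) := by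
  let R : E × E →L[ℝ] E × E :=
    (ρ • ContinuousLinearMap.fst ℝ E E + σ • ContinuousLinearMap.snd ℝ E E).prod
      (σ • ContinuousLinearMap.fst ℝ E E - ρ • ContinuousLinearMap.snd ℝ E E)
  change Measure.map R _ = _
  refine Measure.ext_of_charFunDual (funext fun L => ?_)
  rw [charFunDual_map, charFunDual_prod, charFunDual_prod]
  simp_rw [charFunDual_stdGaussian, ← Complex.exp_add]
  congr 1
  set a := (InnerProductSpace.toDual ℝ E).symm (L.comp (.inl ℝ E E)) with ha
  set b := (InnerProductSpace.toDual ℝ E).symm (L.comp (.inr ℝ E E)) with hb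
  have hla : L.comp (.inl ℝ E E) = InnerProductSpace.toDual ℝ E a := by simp [ha]
  have hlb : L.comp (.inr ℝ E E) = InnerProductSpace.toDual ℝ E b := by simp [hb]
  have hL : ∀ x z : E, L (x, z) = inner ℝ a x + inner ℝ b z := by
    intro x z
    have h1 : L (x, 0) = inner ℝ a x := congrArg (fun f => f x) hla
    have h2 : L (0, z) = inner ℝ b z := congrArg (fun f => f z) hlb
    rw [← h1, ← h2, ← map_add]; simp
  have h1 : (L.comp R).comp (.inl ℝ E E) = InnerProductSpace.toDual ℝ E (ρ • a + σ • b) := by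
    ext x
    simp [R, hL, inner_smul_right]
  have h2 : (L.comp R).comp (.inr ℝ E E) = InnerProductSpace.toDual ℝ E (σ • a - ρ • b) := by
    ext x
    simp [R, hL, inner_smul_right, sub_eq_add_neg]
  rw [h1, h2, hla, hlb]
  simp only [LinearIsometryEquiv.norm_map]
  -- The rotation preserves the quadratic form in the exponent of the characteristic function.
  have key : ‖ρ • a + σ • b‖ ^ 2 + ‖σ • a - ρ • b‖ ^ 2 = ‖a‖ ^ 2 + ‖b‖ ^ 2 := by
    rw [norm_add_sq_real, norm_sub_sq_real]
    simp only [norm_smul, inner_smul_left, inner_smul_right, mul_pow, Real.norm_eq_abs, sq_abs,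
      conj_trivial]
    linear_combination (‖a‖ ^ 2 + ‖b‖ ^ 2) * h
  have key' := congrArg (fun r : ℝ => (r : ℂ)) key
  push_cast at key'
  linear_combination -key' / 2

/-- The distribution function in a direction is continuous, so that a set can be sliced into a
piece of any smaller measure. -/
theorem exists_subset_stdGaussian_real_eq [Nontrivial E] {P : Set E} (hP : MeasurableSet P) {m : ℝ}
    (hm0 : 0 < m) (hm : m < (stdGaussian E).real P) :
    ∃ Q ⊆ P, MeasurableSet Q ∧ (stdGaussian E).real Q = m := by
  obtain ⟨u, hu⟩ := exists_ne (0 : E)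
  let Q : ℝ → Set E := fun τ => P ∩ {x | inner ℝ x u ≤ τ}
  have hQ : ∀ τ, MeasurableSet (Q τ) := fun τ =>
    hP.inter (measurableSet_le (by fun_prop) measurable_const)
  let φ : ℝ → ℝ := fun τ => ∫ x, (Q τ).indicator (fun _ => (1 : ℝ)) x ∂(stdGaussian E)
  have hφ : ∀ τ, φ τ = (stdGaussian E).real (Q τ) := fun τ => by
    simp only [φ]; rw [integral_indicator_const _ (hQ τ)]; simp
  have hb : ∀ τ x, ‖(Q τ).indicator (fun _ => (1 : ℝ)) x‖ ≤ 1 := by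
    intro τ x
    by_cases hx : x ∈ Q τ <;> simp [hx]
  have hmeas : ∀ τ, AEStronglyMeasurable ((Q τ).indicator (fun _ => (1 : ℝ))) (stdGaussian E) :=
    fun τ => (measurable_const.indicator (hQ τ)).aestronglyMeasurable
  have hcont : Continuous φ := by
    rw [continuous_iff_continuousAt]
    intro τ
    refine continuousAt_of_dominated (bound := fun _ => 1) (Filter.Eventually.of_forall hmeas)
      (Filter.Eventually.of_forall fun τ => Filter.Eventually.of_forall (hb τ))
      (integrable_const _) ?_
    have h0 : ∀ᵐ x ∂(stdGaussian E), inner ℝ x u ≠ τ :=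
      measure_eq_zero_iff_ae_notMem.1 (stdGaussian_hyperplane_eq_zero hu τ)
    filter_upwards [h0] with x hx
    refine continuousAt_const.congr (f := fun _ => (Q τ).indicator (fun _ => (1 : ℝ)) x) ?_
    rcases lt_or_gt_of_ne hx with hx | hx
    · filter_upwards [lt_mem_nhds hx] with τ' hτ'
      by_cases hxP : x ∈ P <;> simp [Q, Set.indicator, hxP, hx.le, hτ'.le]
    · filter_upwards [gt_mem_nhds hx] with τ' hτ'
      by_cases hxP : x ∈ P <;> simp [Q, Set.indicator, hxP, hx.not_ge, hτ'.not_ge]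
  have htop : Filter.Tendsto φ Filter.atTop (nhds ((stdGaussian E).real P)) := by
    have : (stdGaussian E).real P = ∫ x, P.indicator (fun _ => (1 : ℝ)) x ∂(stdGaussian E) := by
      rw [integral_indicator_const _ hP]; simp
    rw [this]
    refine tendsto_integral_filter_of_dominated_convergence (fun _ => 1)
      (Filter.Eventually.of_forall hmeas)
      (Filter.Eventually.of_forall fun τ => Filter.Eventually.of_forall (hb τ))
      (integrable_const _) (Filter.Eventually.of_forall fun x => ?_)
    refine tendsto_const_nhds.congr' ?_
    filter_upwards [Filter.eventually_ge_atTop (inner ℝ x u)] with τ hτ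
    by_cases hxP : x ∈ P <;> simp [Q, Set.indicator, hxP, hτ]
  have hbot : Filter.Tendsto φ Filter.atBot (nhds 0) := by
    have : (0 : ℝ) = ∫ x, (0 : ℝ) ∂(stdGaussian E) := by simp
    rw [this]
    refine tendsto_integral_filter_of_dominated_convergence (fun _ => 1)
      (Filter.Eventually.of_forall hmeas)
      (Filter.Eventually.of_forall fun τ => Filter.Eventually.of_forall (hb τ))
      (integrable_const _) (Filter.Eventually.of_forall fun x => ?_)
    refine tendsto_const_nhds.congr' ?_
    filter_upwards [Filter.eventually_lt_atBot (inner ℝ x u)] with τ hτ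
    simp [Q, Set.indicator, hτ]
  obtain ⟨τ, hτ⟩ := mem_range_of_exists_le_of_exists_ge hcont
    ((hbot.eventually (gt_mem_nhds hm0)).exists.imp fun _ h => h.le)
    ((htop.eventually (lt_mem_nhds hm)).exists.imp fun _ h => h.le)
  exact ⟨Q τ, Set.inter_subset_left, hQ τ, by rw [← hφ, hτ]⟩

theorem tendsto_stdGaussian_real_closedBall [Nontrivial E] (c : E) :
    Filter.Tendsto (fun r => (stdGaussian E).real (Metric.closedBall c r))
      (nhdsWithin 0 (Set.Ioi 0)) (nhds 0) := by
  obtain ⟨u, hu⟩ := exists_ne (0 : E)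
  have h0 : stdGaussian E {c} = 0 :=
    measure_mono_null (by simp) (stdGaussian_hyperplane_eq_zero hu (inner ℝ c u))
  have h := (tendsto_measure_cthickening_of_isClosed (μ := stdGaussian E) (s := {c})
    ⟨1, one_pos, measure_ne_top _ _⟩ isClosed_singleton).mono_left
      (nhdsWithin_le_nhds (s := Set.Ioi 0))
  rw [h0] at h
  have h' := (ENNReal.tendsto_toReal ENNReal.zero_ne_top).comp h
  rw [ENNReal.toReal_zero] at h'
  refine h'.congr' ?_
  filter_upwards [self_mem_nhdsWithin] with r hr
  simp only [Function.comp, Metric.cthickening_singleton c (le_of_lt hr)]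
  rfl

end GaussianFacts
end

noncomputable section

/-! ### The symmetric bilinear form attached to the noise operator. -/

section NoiseForm

variable {n : ℕ}

/-- Bounded measurable functions. -/
def IsBoundedMeasurable (f : EuclideanSpace ℝ (Fin n) → ℝ) : Prop :=
  Measurable f ∧ ∃ C, ∀ x, |f x| ≤ C

namespace IsBoundedMeasurable

variable {f g : EuclideanSpace ℝ (Fin n) → ℝ}

theorem add (hf : IsBoundedMeasurable f) (hg : IsBoundedMeasurable g) :
    IsBoundedMeasurable (f + g) := by
  obtain ⟨hf, C, hC⟩ := hf
  obtain ⟨hg, D, hD⟩ := hg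
  exact ⟨hf.add hg, C + D, fun x => (abs_add_le _ _).trans (add_le_add (hC x) (hD x))⟩

theorem sub (hf : IsBoundedMeasurable f) (hg : IsBoundedMeasurable g) :
    IsBoundedMeasurable (f - g) := by
  obtain ⟨hf, C, hC⟩ := hf
  obtain ⟨hg, D, hD⟩ := hg
  exact ⟨hf.sub hg, C + D, fun x => (abs_sub _ _).trans (add_le_add (hC x) (hD x))⟩

theorem indicator_one {A : Set (EuclideanSpace ℝ (Fin n))} (hA : MeasurableSet A) :
    IsBoundedMeasurable (A.indicator (fun _ => (1 : ℝ))) := by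
  refine ⟨measurable_const.indicator hA, 1, fun x => ?_⟩
  by_cases hx : x ∈ A <;> simp [hx]

theorem integrable_noise (hf : IsBoundedMeasurable f) (ρ : ℝ) (x : EuclideanSpace ℝ (Fin n)) :
    Integrable (fun z => f (ρ • x + Real.sqrt (1 - ρ ^ 2) • z))
      (stdGaussian (EuclideanSpace ℝ (Fin n))) := by
  obtain ⟨hf, C, hC⟩ := hf
  exact Integrable.of_bound (hf.comp (by fun_prop)).aestronglyMeasurable C
    (Filter.Eventually.of_forall fun z => hC _)

theorem integrable_pair (hf : IsBoundedMeasurable f) (hg : IsBoundedMeasurable g) (ρ : ℝ) :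
    Integrable (fun p : EuclideanSpace ℝ (Fin n) × EuclideanSpace ℝ (Fin n) =>
      f p.1 * g (ρ • p.1 + Real.sqrt (1 - ρ ^ 2) • p.2))
      ((stdGaussian (EuclideanSpace ℝ (Fin n))).prod (stdGaussian _)) := by
  obtain ⟨hf, C, hC⟩ := hf
  obtain ⟨hg, D, hD⟩ := hg
  refine Integrable.of_bound
    ((hf.comp measurable_fst).mul (hg.comp (by fun_prop))).aestronglyMeasurable (C * D)
    (Filter.Eventually.of_forall fun p => ?_)
  rw [Real.norm_eq_abs, abs_mul]
  exact mul_le_mul (hC _) (hD _) (abs_nonneg _) ((abs_nonneg _).trans (hC p.1))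

end IsBoundedMeasurable

open IsBoundedMeasurable

variable {f g h : EuclideanSpace ℝ (Fin n) → ℝ} {ρ : ℝ}

theorem noiseOperator_add (hf : IsBoundedMeasurable f) (hg : IsBoundedMeasurable g)
    (x : EuclideanSpace ℝ (Fin n)) :
    noiseOperator ρ (f + g) x = noiseOperator ρ f x + noiseOperator ρ g x :=
  integral_add (hf.integrable_noise ρ x) (hg.integrable_noise ρ x)

theorem noiseOperator_sub (hf : IsBoundedMeasurable f) (hg : IsBoundedMeasurable g)
    (x : EuclideanSpace ℝ (Fin n)) :
    noiseOperator ρ (f - g) x = noiseOperator ρ f x - noiseOperator ρ g x :=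
  integral_sub (hf.integrable_noise ρ x) (hg.integrable_noise ρ x)

/-- The bilinear form `(f, g) ↦ ∫ f · T_ρ g dγ_n`, as an integral over `γ_n ⊗ γ_n`. -/
def noiseForm (ρ : ℝ) (f g : EuclideanSpace ℝ (Fin n) → ℝ) : ℝ :=
  ∫ p, f p.1 * g (ρ • p.1 + Real.sqrt (1 - ρ ^ 2) • p.2)
    ∂((stdGaussian (EuclideanSpace ℝ (Fin n))).prod (stdGaussian _))

theorem integral_mul_noiseOperator (hf : IsBoundedMeasurable f) (hg : IsBoundedMeasurable g) :
    ∫ x, f x * noiseOperator ρ g x ∂(stdGaussian _) = noiseForm ρ f g := by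
  rw [noiseForm, integral_prod _ (hf.integrable_pair hg ρ)]
  simp_rw [integral_const_mul]
  rfl

theorem integrable_mul_noiseOperator (hf : IsBoundedMeasurable f) (hg : IsBoundedMeasurable g) :
    Integrable (fun x => f x * noiseOperator ρ g x) (stdGaussian _) := by
  have := (hf.integrable_pair hg ρ).integral_prod_left
  simp_rw [integral_const_mul] at this
  exact this

theorem noiseForm_add_left (hf : IsBoundedMeasurable f) (hg : IsBoundedMeasurable g)
    (hh : IsBoundedMeasurable h) :
    noiseForm ρ (f + g) h = noiseForm ρ f h + noiseForm ρ g h := by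
  simp only [noiseForm, Pi.add_apply, add_mul]
  exact integral_add (hf.integrable_pair hh ρ) (hg.integrable_pair hh ρ)

theorem noiseForm_sub_left (hf : IsBoundedMeasurable f) (hg : IsBoundedMeasurable g)
    (hh : IsBoundedMeasurable h) :
    noiseForm ρ (f - g) h = noiseForm ρ f h - noiseForm ρ g h := by
  simp only [noiseForm, Pi.sub_apply, sub_mul]
  exact integral_sub (hf.integrable_pair hh ρ) (hg.integrable_pair hh ρ)

/-- The rotation that sends `(X, Z)` to `(ρ X + σ Z, σ X - ρ Z)` is an involution preserving the
law, and it exchanges the two arguments `X` and `ρ X + σ Z` of the form. -/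
theorem noiseForm_comm (hρ : |ρ| ≤ 1) (hf : IsBoundedMeasurable f)
    (hg : IsBoundedMeasurable g) : noiseForm ρ f g = noiseForm ρ g f := by
  have hs : 0 ≤ 1 - ρ ^ 2 := by nlinarith [abs_le.1 hρ]
  have hsq := Real.sq_sqrt hs
  set σ := Real.sqrt (1 - ρ ^ 2) with hσ
  have h1 : ρ ^ 2 + σ ^ 2 = 1 := by linarith
  have hmap := stdGaussian_prod_map_rotation (E := EuclideanSpace ℝ (Fin n)) h1
  rw [noiseForm, ← hmap, integral_map (by fun_prop), noiseForm]
  · refine integral_congr_ae (Filter.Eventually.of_forall fun p => ?_)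
    have h2 : ρ • (ρ • p.1 + σ • p.2) + σ • (σ • p.1 - ρ • p.2) = p.1 := by
      have : ρ • (ρ • p.1 + σ • p.2) + σ • (σ • p.1 - ρ • p.2) = (ρ ^ 2 + σ ^ 2) • p.1 := by
        module
      rw [this, h1, one_smul]
    simp only [← hσ, h2]
    ring
  · rw [hmap]
    exact (hf.integrable_pair hg ρ).aestronglyMeasurable

theorem noiseForm_add_right (hρ : |ρ| ≤ 1) (hf : IsBoundedMeasurable f)
    (hg : IsBoundedMeasurable g) (hh : IsBoundedMeasurable h) :
    noiseForm ρ h (f + g) = noiseForm ρ h f + noiseForm ρ h g := by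
  rw [noiseForm_comm hρ hh (hf.add hg), noiseForm_add_left hf hg hh, noiseForm_comm hρ hf hh,
    noiseForm_comm hρ hg hh]

theorem noiseForm_sub_right (hρ : |ρ| ≤ 1) (hf : IsBoundedMeasurable f)
    (hg : IsBoundedMeasurable g) (hh : IsBoundedMeasurable h) :
    noiseForm ρ h (f - g) = noiseForm ρ h f - noiseForm ρ h g := by
  rw [noiseForm_comm hρ hh (hf.sub hg), noiseForm_sub_left hf hg hh, noiseForm_comm hρ hf hh,
    noiseForm_comm hρ hg hh]

/-- The exact expansion of the stability when mass `h` is moved from `g` to `f`: the linear part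
pairs `h` with `f - g`, and the remainder is quadratic in `h`. -/
theorem noiseForm_transfer (hρ : |ρ| ≤ 1) (hf : IsBoundedMeasurable f)
    (hg : IsBoundedMeasurable g) (hh : IsBoundedMeasurable h) :
    noiseForm ρ (f + h) (f + h) - noiseForm ρ f f + (noiseForm ρ (g - h) (g - h) - noiseForm ρ g g) =
      2 * noiseForm ρ h (f - g + h) := by
  rw [noiseForm_add_left hf hh (hf.add hh), noiseForm_add_right hρ hf hh hf,
    noiseForm_add_right hρ hf hh hh, noiseForm_sub_left hg hh (hg.sub hh),
    noiseForm_sub_right hρ hg hh hg, noiseForm_sub_right hρ hg hh hh,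
    noiseForm_add_right hρ (hf.sub hg) hh hh, noiseForm_sub_right hρ hf hg hh,
    noiseForm_comm hρ hf hh, noiseForm_comm hρ hg hh]
  ring

theorem noiseOperator_indicator (ρ : ℝ) {A : Set (EuclideanSpace ℝ (Fin n))}
    (hA : MeasurableSet A) (x : EuclideanSpace ℝ (Fin n)) :
    noiseOperator ρ (A.indicator (fun _ => (1 : ℝ))) x =
      (stdGaussian (EuclideanSpace ℝ (Fin n))).real
        {z | ρ • x + Real.sqrt (1 - ρ ^ 2) • z ∈ A} := by
  have hm : MeasurableSet {z | ρ • x + Real.sqrt (1 - ρ ^ 2) • z ∈ A} :=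
    (by fun_prop : Measurable fun z : EuclideanSpace ℝ (Fin n) =>
      ρ • x + Real.sqrt (1 - ρ ^ 2) • z) hA
  have := integral_indicator_const (μ := stdGaussian (EuclideanSpace ℝ (Fin n))) (1 : ℝ) hm
  simp only [smul_eq_mul, mul_one] at this
  rw [← this]
  rfl

theorem noiseStability_eq_sum_noiseForm {k : ℕ} (ρ : ℝ)
    {A : Fin k → Set (EuclideanSpace ℝ (Fin n))} (hA : ∀ i, MeasurableSet (A i)) :
    noiseStability ρ A = ∑ i, noiseForm ρ ((A i).indicator (fun _ => (1 : ℝ)))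
      ((A i).indicator (fun _ => (1 : ℝ))) :=
  Finset.sum_congr rfl fun i _ =>
    integral_mul_noiseOperator (indicator_one (hA i)) (indicator_one (hA i))

theorem one_sub_sq_pos_of_abs_lt_one (hρ : |ρ| < 1) : 0 < 1 - ρ ^ 2 := by
  nlinarith [abs_lt.1 hρ]

/-- The noise operator is uniformly small on indicators of subsets of small balls. -/
theorem eventually_noiseOperator_indicator_le [Nontrivial (EuclideanSpace ℝ (Fin n))]
    (hρ : |ρ| < 1) (c x₀ : EuclideanSpace ℝ (Fin n)) {δ : ℝ} (hδ : 0 < δ) :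
    ∀ᶠ r in nhdsWithin (0 : ℝ) (Set.Ioi 0), ∀ x ∈ Metric.ball x₀ r, ∀ P ⊆ Metric.ball c r,
      MeasurableSet P → noiseOperator ρ (P.indicator (fun _ => (1 : ℝ))) x ≤ δ := by
  have hs : 0 < Real.sqrt (1 - ρ ^ 2) := Real.sqrt_pos.2 (one_sub_sq_pos_of_abs_lt_one hρ)
  set s := Real.sqrt (1 - ρ ^ 2) with hs_def
  -- If `x` is within `r` of `x₀` and `ρ x + s z` is within `r` of `c`, then `z` is within `(1 +
  -- |ρ|) r / s`, hence within `2 r / s`, of a centre that does not depend on `x`. This gives the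
  -- uniformity.
  have h1 : Filter.Tendsto (fun r : ℝ => s⁻¹ * 2 * r) (nhdsWithin 0 (Set.Ioi 0))
      (nhdsWithin 0 (Set.Ioi 0)) := by
    refine tendsto_nhdsWithin_iff.2 ⟨?_, ?_⟩
    · have : Filter.Tendsto (fun r : ℝ => s⁻¹ * 2 * r) (nhds 0) (nhds (s⁻¹ * 2 * 0)) :=
        (continuous_const.mul continuous_id).tendsto 0
      rw [mul_zero] at this
      exact this.mono_left nhdsWithin_le_nhds
    · filter_upwards [self_mem_nhdsWithin] with r hr
      have hr : 0 < r := hr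
      exact Set.mem_Ioi.2 (by positivity)
  have h2 := ((tendsto_stdGaussian_real_closedBall (s⁻¹ • (c - ρ • x₀))).comp h1).eventually
    (gt_mem_nhds hδ)
  filter_upwards [h2, self_mem_nhdsWithin] with r hr hr0 x hx P hP hPm
  rw [noiseOperator_indicator ρ hPm]
  refine (measureReal_mono ?_).trans hr.le
  intro z hz
  have hz' : ρ • x + s • z ∈ Metric.ball c r := hP hz
  rw [Metric.mem_closedBall, dist_eq_norm]
  have h3 : z - s⁻¹ • (c - ρ • x₀) = s⁻¹ • ((ρ • x + s • z - c) - ρ • (x - x₀)) := by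
    have : z = s⁻¹ • (s • z) := by rw [smul_smul, inv_mul_cancel₀ hs.ne', one_smul]
    nth_rewrite 1 [this]
    module
  rw [h3, norm_smul, Real.norm_of_nonneg (inv_pos.2 hs).le]
  simp only [mul_assoc]
  refine mul_le_mul_of_nonneg_left ?_ (inv_pos.2 hs).le
  refine (norm_sub_le _ _).trans ?_
  rw [norm_smul, Real.norm_eq_abs]
  have h4 : ‖ρ • x + s • z - c‖ < r := by rwa [← dist_eq_norm]
  have h5 : ‖x - x₀‖ < r := by rwa [← dist_eq_norm]
  nlinarith [norm_nonneg (x - x₀), abs_nonneg ρ]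

end NoiseForm

/-! ### First variation of the stability under volume-preserving exchanges. -/

section Exchange

variable {n k : ℕ} {ρ : ℝ} {A : Fin k → Set (EuclideanSpace ℝ (Fin n))}

open IsBoundedMeasurable

/-- The points of `A i` that lie in no other set of the family. -/
def ownPart (A : Fin k → Set (EuclideanSpace ℝ (Fin n))) (i : Fin k) :
    Set (EuclideanSpace ℝ (Fin n)) :=
  A i ∩ ⋂ l, ⋂ (_ : l ≠ i), (A l)ᶜ

theorem measurableSet_ownPart (hA : ∀ i, MeasurableSet (A i)) (i : Fin k) :
    MeasurableSet (ownPart A i) :=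
  (hA i).inter (MeasurableSet.iInter fun l => MeasurableSet.iInter fun _ => (hA l).compl)

theorem mem_ownPart {i : Fin k} {x : EuclideanSpace ℝ (Fin n)} :
    x ∈ ownPart A i ↔ x ∈ A i ∧ ∀ l, l ≠ i → x ∉ A l := by
  simp [ownPart]

/-- Moving `P` from `A i` to `A j` and `Q` from `A j` to `A i`. -/
theorem exists_exchange (hρ : |ρ| ≤ 1) (hA : IsGaussianPartition A) {i j : Fin k} (hij : i ≠ j)
    {P Q : Set (EuclideanSpace ℝ (Fin n))} (hPm : MeasurableSet P) (hQm : MeasurableSet Q)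
    (hP : P ⊆ ownPart A i) (hQ : Q ⊆ ownPart A j)
    (hPQ : (stdGaussian (EuclideanSpace ℝ (Fin n))).real P =
      (stdGaussian (EuclideanSpace ℝ (Fin n))).real Q) :
    ∃ B : Fin k → Set (EuclideanSpace ℝ (Fin n)), IsGaussianPartition B ∧
      (∀ a, HasVolumes A a → HasVolumes B a) ∧
      noiseStability ρ B - noiseStability ρ A =
        2 * noiseForm ρ (Q.indicator (fun _ => (1 : ℝ)) - P.indicator (fun _ => (1 : ℝ)))
          ((A i).indicator (fun _ => (1 : ℝ)) - (A j).indicator (fun _ => (1 : ℝ)) +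
            (Q.indicator (fun _ => (1 : ℝ)) - P.indicator (fun _ => (1 : ℝ)))) := by
  have hPi : P ⊆ A i := fun x hx => (mem_ownPart.1 (hP hx)).1
  have hQj : Q ⊆ A j := fun x hx => (mem_ownPart.1 (hQ hx)).1
  have hPl : ∀ l, l ≠ i → ∀ x ∈ P, x ∉ A l := fun l hl x hx => (mem_ownPart.1 (hP hx)).2 l hl
  have hQl : ∀ l, l ≠ j → ∀ x ∈ Q, x ∉ A l := fun l hl x hx => (mem_ownPart.1 (hQ hx)).2 l hl
  let B : Fin k → Set (EuclideanSpace ℝ (Fin n)) := fun l =>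
    if l = i then (A i \ P) ∪ Q else if l = j then (A j \ Q) ∪ P else A l
  have hBi : B i = (A i \ P) ∪ Q := by simp [B]
  have hBj : B j = (A j \ Q) ∪ P := by simp [B, hij.symm]
  have hBl : ∀ l, l ≠ i → l ≠ j → B l = A l := fun l h1 h2 => by simp [B, h1, h2]
  have hBm : ∀ l, MeasurableSet (B l) := by
    intro l
    by_cases h1 : l = i
    · subst h1; rw [hBi]; exact ((hA.measurableSet _).diff hPm).union hQm
    by_cases h2 : l = j
    · subst h2; rw [hBj]; exact ((hA.measurableSet _).diff hQm).union hPm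
    rw [hBl l h1 h2]; exact hA.measurableSet l
  -- Pieces taken from own parts meet no other set of the family, so the exchange creates no new
  -- overlaps.
  have hBsub : ∀ l m, l ≠ m → B l ∩ B m ⊆ A l ∩ A m := by
    intro l m hlm x hx
    have key : ∀ l, x ∈ B l → (x ∈ P ∧ l = j) ∨ (x ∈ Q ∧ l = i) ∨
        (x ∈ A l ∧ (l = i → x ∉ P) ∧ (l = j → x ∉ Q)) := by
      intro l hl
      by_cases h1 : l = i
      · subst h1; rw [hBi] at hl
        rcases hl with hl | hl
        · exact Or.inr (Or.inr ⟨hl.1, fun _ => hl.2, fun h => absurd h hij⟩)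
        · exact Or.inr (Or.inl ⟨hl, rfl⟩)
      by_cases h2 : l = j
      · subst h2; rw [hBj] at hl
        rcases hl with hl | hl
        · exact Or.inr (Or.inr ⟨hl.1, fun h => absurd h h1, fun _ => hl.2⟩)
        · exact Or.inl ⟨hl, rfl⟩
      rw [hBl l h1 h2] at hl
      exact Or.inr (Or.inr ⟨hl, fun h => absurd h h1, fun h => absurd h h2⟩)
    have hPQx : x ∈ P → x ∉ Q := fun h1 h2 => hPl j hij.symm x h1 (hQj h2)
    have k1 := key l hx.1
    have k2 := key m hx.2
    have p1 : x ∈ P → ∀ l, l ≠ i → x ∉ A l := fun h l hl => hPl l hl x h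
    have q1 : x ∈ Q → ∀ l, l ≠ j → x ∉ A l := fun h l hl => hQl l hl x h
    rcases k1 with ⟨h, rfl⟩ | ⟨h, rfl⟩ | ⟨h, hi, hj⟩
    · rcases k2 with ⟨_, rfl⟩ | ⟨h', rfl⟩ | ⟨h', hi', -⟩
      · exact absurd rfl hlm
      · exact absurd h' (hPQx h)
      · by_cases hm : m = i
        · exact absurd h (hi' hm)
        · exact absurd h' (p1 h m hm)
    · rcases k2 with ⟨h', rfl⟩ | ⟨_, rfl⟩ | ⟨h', -, hj'⟩
      · exact absurd h (hPQx h')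
      · exact absurd rfl hlm
      · by_cases hm : m = j
        · exact absurd h (hj' hm)
        · exact absurd h' (q1 h m hm)
    · rcases k2 with ⟨h', rfl⟩ | ⟨h', rfl⟩ | ⟨h', -, -⟩
      · by_cases hl : l = i
        · exact absurd h' (hi hl)
        · exact absurd h (p1 h' l hl)
      · by_cases hl : l = j
        · exact absurd h' (hj hl)
        · exact absurd h (q1 h' l hl)
      · exact ⟨h, h'⟩
  have hBpart : IsGaussianPartition B := by
    refine ⟨hBm, ?_, fun l m hlm => measure_mono_null (hBsub l m hlm) (hA.null_inter l m hlm)⟩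
    refine Set.eq_univ_of_forall fun x => ?_
    rw [Set.mem_iUnion]
    by_cases hxP : x ∈ P
    · exact ⟨j, by rw [hBj]; exact Or.inr hxP⟩
    by_cases hxQ : x ∈ Q
    · exact ⟨i, by rw [hBi]; exact Or.inr hxQ⟩
    have hx : x ∈ ⋃ l, A l := by rw [hA.iUnion_eq]; trivial
    obtain ⟨l, hl⟩ := Set.mem_iUnion.1 hx
    refine ⟨l, ?_⟩
    by_cases h1 : l = i
    · subst h1; rw [hBi]; exact Or.inl ⟨hl, hxP⟩
    by_cases h2 : l = j
    · subst h2; rw [hBj]; exact Or.inl ⟨hl, hxQ⟩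
    rwa [hBl l h1 h2]
  refine ⟨B, hBpart, ?_, ?_⟩
  · intro a ha l
    by_cases h1 : l = i
    · subst h1
      rw [hBi, measureReal_union (Set.disjoint_left.2 fun x hx hxQ => hQl _ hij x hxQ hx.1) hQm,
        measureReal_sdiff hPi hPm, ha, hPQ]
      ring
    by_cases h2 : l = j
    · subst h2
      rw [hBj, measureReal_union (Set.disjoint_left.2 fun x hx hxP => hPl _ h1 x hxP hx.1) hPm,
        measureReal_sdiff hQj hQm, ha, hPQ]
      ring
    rw [hBl l h1 h2, ha]
  · have hIi : (B i).indicator (fun _ => (1 : ℝ)) = (A i).indicator (fun _ => (1 : ℝ)) +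
        (Q.indicator (fun _ => (1 : ℝ)) - P.indicator (fun _ => (1 : ℝ))) := by
      ext x
      have h1 := @hPi x
      have h2 := hQl i hij x
      have h3 := hPl j hij.symm x
      have h4 := @hQj x
      rw [hBi]
      by_cases hxP : x ∈ P <;> by_cases hxQ : x ∈ Q <;> by_cases hxA : x ∈ A i <;>
        simp_all [Set.indicator]
    have hIj : (B j).indicator (fun _ => (1 : ℝ)) = (A j).indicator (fun _ => (1 : ℝ)) -
        (Q.indicator (fun _ => (1 : ℝ)) - P.indicator (fun _ => (1 : ℝ))) := by
      ext x
      have h1 := @hPi x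
      have h2 := hQl i hij x
      have h3 := hPl j hij.symm x
      have h4 := @hQj x
      rw [hBj]
      by_cases hxP : x ∈ P <;> by_cases hxQ : x ∈ Q <;> by_cases hxA : x ∈ A j <;>
        simp_all [Set.indicator]
    rw [noiseStability_eq_sum_noiseForm ρ hBm, noiseStability_eq_sum_noiseForm ρ hA.measurableSet,
      ← Finset.sum_sub_distrib, Finset.sum_eq_add i j hij, hIi, hIj, noiseForm_transfer hρ]
    · exact indicator_one (hA.measurableSet i)
    · exact indicator_one (hA.measurableSet j)
    · exact (indicator_one hQm).sub (indicator_one hPm)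
    · rintro l - ⟨h1, h2⟩
      rw [hBl l h1 h2, sub_self]
    · simp
    · simp

theorem abs_setIntegral_sub_le {X : Type*} [MeasurableSpace X] {μ : Measure X} [IsFiniteMeasure μ]
    {H : X → ℝ} {P : Set X} (hH : IntegrableOn H P μ) {c δ : ℝ}
    (h : ∀ x ∈ P, |H x - c| ≤ δ) : |∫ x in P, H x ∂μ - μ.real P * c| ≤ δ * μ.real P := by
  have h1 : ∫ x in P, H x ∂μ - μ.real P * c = ∫ x in P, (H x - c) ∂μ := by
    rw [integral_sub hH (integrable_const c), integral_const]
    simp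
  rw [h1, ← Real.norm_eq_abs]
  exact norm_setIntegral_le_of_norm_le_const (measure_lt_top μ P) fun x hx => h x hx

/-- The first variation of the noise stability: an exchange of small pieces of `A i` and `A j` near
`p` and `q` changes it, to first order, in proportion to the difference of the values of
`T_ρ (1_{A i} - 1_{A j})` at `q` and `p`. -/
theorem exists_small_exchange [Nontrivial (EuclideanSpace ℝ (Fin n))] (hρ : |ρ| < 1)
    (hA : IsGaussianPartition A) {i j : Fin k} (hij : i ≠ j) {p q : EuclideanSpace ℝ (Fin n)}
    {F : EuclideanSpace ℝ (Fin n) → ℝ}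
    (hF : ∀ x, F x = noiseOperator ρ ((A i).indicator (fun _ => (1 : ℝ))) x -
      noiseOperator ρ ((A j).indicator (fun _ => (1 : ℝ))) x)
    (hFp : ContinuousAt F p) (hFq : ContinuousAt F q)
    (hp : ∀ r > 0, 0 < (stdGaussian (EuclideanSpace ℝ (Fin n))).real
      (Metric.ball p r ∩ ownPart A i))
    (hq : ∀ r > 0, 0 < (stdGaussian (EuclideanSpace ℝ (Fin n))).real
      (Metric.ball q r ∩ ownPart A j)) {η : ℝ} (hη : 0 < η) :
    ∃ B : Fin k → Set (EuclideanSpace ℝ (Fin n)), IsGaussianPartition B ∧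
      (∀ a, HasVolumes A a → HasVolumes B a) ∧ ∃ ε > 0,
      |noiseStability ρ B - noiseStability ρ A - 2 * ε * (F q - F p)| ≤ η * ε := by
  -- Each of the two pieces contributes an error `3 δ ε`, and the form enters with a factor 2, for a
  -- total of `12 δ ε`.
  set δ := η / 12 with hδ_def
  have hδ : 0 < δ := by positivity
  have hFev : ∀ c, ContinuousAt F c → ∀ᶠ r in nhdsWithin (0 : ℝ) (Set.Ioi 0),
      ∀ x ∈ Metric.ball c r, |F x - F c| ≤ δ := by
    intro c hc
    obtain ⟨r₀, hr₀, h⟩ := Metric.continuousAt_iff.1 hc δ hδ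
    filter_upwards [Ioo_mem_nhdsGT hr₀] with r hr x hx
    exact (h (lt_trans hx hr.2)).le
  have hpos : ∀ᶠ r in nhdsWithin (0 : ℝ) (Set.Ioi 0), 0 < r := self_mem_nhdsWithin
  obtain ⟨r, hr, hr0, h1, h2, h3, h4, h5⟩ := ((hFev p hFp).and
    (hpos.and ((hFev q hFq).and
    ((eventually_noiseOperator_indicator_le hρ p p hδ).and
    ((eventually_noiseOperator_indicator_le hρ p q hδ).and
    ((eventually_noiseOperator_indicator_le hρ q p hδ).and
    (eventually_noiseOperator_indicator_le hρ q q hδ))))))).exists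
  have hmp := hp r hr0
  have hmq := hq r hr0
  set mp := (stdGaussian (EuclideanSpace ℝ (Fin n))).real (Metric.ball p r ∩ ownPart A i)
  set mq := (stdGaussian (EuclideanSpace ℝ (Fin n))).real (Metric.ball q r ∩ ownPart A j)
  -- Halving makes `ε` strictly smaller than both available masses, as the slicing lemma demands.
  set ε := min mp mq / 2 with hε_def
  have hmin : 0 < min mp mq := lt_min hmp hmq
  have hε : 0 < ε := by positivity
  obtain ⟨P, hPs, hPm, hPε⟩ := exists_subset_stdGaussian_real_eq
    (Metric.isOpen_ball.measurableSet.inter (measurableSet_ownPart hA.measurableSet i)) hε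
    (by have := min_le_left mp mq; change ε < mp; linarith)
  obtain ⟨Q, hQs, hQm, hQε⟩ := exists_subset_stdGaussian_real_eq
    (Metric.isOpen_ball.measurableSet.inter (measurableSet_ownPart hA.measurableSet j)) hε
    (by have := min_le_right mp mq; change ε < mq; linarith)
  have hPb : P ⊆ Metric.ball p r := hPs.trans Set.inter_subset_left
  have hQb : Q ⊆ Metric.ball q r := hQs.trans Set.inter_subset_left
  obtain ⟨B, hB, hvol, hS⟩ := exists_exchange hρ.le hA hij hPm hQm
    (hPs.trans Set.inter_subset_right) (hQs.trans Set.inter_subset_right) (hPε.trans hQε.symm)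
  refine ⟨B, hB, hvol, ε, hε, ?_⟩
  have hAi := indicator_one (hA.measurableSet i)
  have hAj := indicator_one (hA.measurableSet j)
  have hg := (indicator_one hQm).sub (indicator_one hPm)
  set g := Q.indicator (fun _ => (1 : ℝ)) - P.indicator (fun _ => (1 : ℝ)) with hg_def
  set H := noiseOperator ρ
    ((A i).indicator (fun _ => (1 : ℝ)) - (A j).indicator (fun _ => (1 : ℝ)) + g) with hH_def
  -- The difference between the exact variation `H` and its linear part `F` is `T_ρ` of the moved
  -- pieces. It is uniformly small because these lie in small balls.
  have hHF : ∀ x, H x - F x = noiseOperator ρ (Q.indicator (fun _ => (1 : ℝ))) x -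
      noiseOperator ρ (P.indicator (fun _ => (1 : ℝ))) x := by
    intro x
    rw [hH_def, noiseOperator_add (hAi.sub hAj) hg, noiseOperator_sub hAi hAj, hF x, hg_def,
      noiseOperator_sub (indicator_one hQm) (indicator_one hPm)]
    ring
  have hHP : ∀ x ∈ P, |H x - F p| ≤ 3 * δ := by
    intro x hx
    have e1 := abs_le.1 (hr x (hPb hx))
    have e2 := h2 x (hPb hx) P hPb hPm
    have e3 := h4 x (hPb hx) Q hQb hQm
    have e4 := (noiseOperator_indicator_mem ρ P x).1
    have e5 := (noiseOperator_indicator_mem ρ Q x).1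
    have e6 := hHF x
    exact abs_le.2 ⟨by linarith, by linarith⟩
  have hHQ : ∀ x ∈ Q, |H x - F q| ≤ 3 * δ := by
    intro x hx
    have e1 := abs_le.1 (h1 x (hQb hx))
    have e2 := h3 x (hQb hx) P hPb hPm
    have e3 := h5 x (hQb hx) Q hQb hQm
    have e4 := (noiseOperator_indicator_mem ρ P x).1
    have e5 := (noiseOperator_indicator_mem ρ Q x).1
    have e6 := hHF x
    exact abs_le.2 ⟨by linarith, by linarith⟩
  have hind : ∀ C : Set (EuclideanSpace ℝ (Fin n)),
      (fun x => C.indicator (fun _ => (1 : ℝ)) x * H x) = C.indicator H := by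
    intro C
    ext x
    by_cases hx : x ∈ C <;> simp [hx]
  have hint : ∀ C, MeasurableSet C → IntegrableOn H C (stdGaussian _) := by
    intro C hC
    rw [← integrable_indicator_iff hC, ← hind]
    exact integrable_mul_noiseOperator (indicator_one hC) ((hAi.sub hAj).add hg)
  have hform : noiseForm ρ g ((A i).indicator (fun _ => (1 : ℝ)) -
      (A j).indicator (fun _ => (1 : ℝ)) + g) =
      ∫ x in Q, H x ∂(stdGaussian _) - ∫ x in P, H x ∂(stdGaussian _) := by
    nth_rewrite 1 [hg_def]
    rw [noiseForm_sub_left (indicator_one hQm) (indicator_one hPm) ((hAi.sub hAj).add hg),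
      ← integral_mul_noiseOperator (indicator_one hQm) ((hAi.sub hAj).add hg),
      ← integral_mul_noiseOperator (indicator_one hPm) ((hAi.sub hAj).add hg), hind, hind,
      integral_indicator hQm, integral_indicator hPm]
  have eP := abs_le.1 (abs_setIntegral_sub_le (hint P hPm) hHP)
  have eQ := abs_le.1 (abs_setIntegral_sub_le (hint Q hQm) hHQ)
  rw [hPε] at eP
  rw [hQε] at eQ
  rw [hS, hform]
  have e7 : η * ε = 12 * (δ * ε) := by rw [hδ_def]; ring
  exact abs_le.2 ⟨by linarith [eP.1, eP.2, eQ.1, eQ.2], by linarith [eP.1, eP.2, eQ.1, eQ.2]⟩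

/-- If `T_ρ (1_{A i} - 1_{A j})` takes two values on the common boundary of `A i` and `A j`, then
`A` neither maximizes nor minimizes the noise stability. -/
theorem exists_lt_and_exists_gt_of_ne [Nontrivial (EuclideanSpace ℝ (Fin n))] (hρ : |ρ| < 1)
    (hA : IsGaussianPartition A) {i j : Fin k} (hij : i ≠ j) {p q : EuclideanSpace ℝ (Fin n)}
    {F : EuclideanSpace ℝ (Fin n) → ℝ}
    (hF : ∀ x, F x = noiseOperator ρ ((A i).indicator (fun _ => (1 : ℝ))) x -
      noiseOperator ρ ((A j).indicator (fun _ => (1 : ℝ))) x)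
    (hFc : Continuous F)
    (hp : ∀ l ∈ ({i, j} : Set (Fin k)), ∀ r > 0,
      0 < (stdGaussian (EuclideanSpace ℝ (Fin n))).real (Metric.ball p r ∩ ownPart A l))
    (hq : ∀ l ∈ ({i, j} : Set (Fin k)), ∀ r > 0,
      0 < (stdGaussian (EuclideanSpace ℝ (Fin n))).real (Metric.ball q r ∩ ownPart A l))
    (hpq : F p ≠ F q) {a : Fin k → ℝ} (ha : HasVolumes A a) :
    (∃ s ∈ stabilityValues (n := n) ρ a, noiseStability ρ A < s) ∧
      ∃ s ∈ stabilityValues (n := n) ρ a, s < noiseStability ρ A := by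
  wlog hlt : F p < F q generalizing p q
  · exact this hq hp hpq.symm (lt_of_le_of_ne (not_lt.1 hlt) hpq.symm)
  -- Taking from `A i` near `p` and from `A j` near `q` increases the stability; taking from `A i`
  -- near `q` and from `A j` near `p` decreases it. In both cases the error is taken to be `F q - F
  -- p` times `ε`, half of the main term.
  constructor
  · obtain ⟨B, hB, hvol, ε, hε, h⟩ := exists_small_exchange hρ hA hij hF hFc.continuousAt
      hFc.continuousAt (hp i (by simp)) (hq j (by simp)) (sub_pos.2 hlt)
    refine ⟨_, ⟨B, hB, hvol a ha, rfl⟩, ?_⟩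
    nlinarith [abs_le.1 h, mul_pos hε (sub_pos.2 hlt)]
  · obtain ⟨B, hB, hvol, ε, hε, h⟩ := exists_small_exchange hρ hA hij hF hFc.continuousAt
      hFc.continuousAt (hq i (by simp)) (hp j (by simp)) (sub_pos.2 hlt)
    refine ⟨_, ⟨B, hB, hvol a ha, rfl⟩, ?_⟩
    nlinarith [abs_le.1 h, mul_pos hε (sub_pos.2 hlt)]

end Exchange
end

noncomputable section

/-! ### Connectedness of the graph of a polytope. -/

section Adjacency

variable {E : Type*} [NormedAddCommGroup E] [InnerProductSpace ℝ E]

/-- A nonempty open set is not covered by finitely many hyperplanes through the origin. -/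
theorem IsOpen.exists_forall_inner_ne_zero [FiniteDimensional ℝ E] [MeasurableSpace E]
    [BorelSpace E] {U : Set E}
    (hU : IsOpen U) (hne : U.Nonempty) {κ : Type*} [Countable κ] {m : κ → E}
    (hm : ∀ c, m c ≠ 0) : ∃ x ∈ U, ∀ c, inner ℝ x (m c) ≠ 0 := by
  by_contra! h
  have h1 : U ⊆ ⋃ c, {x | inner ℝ x (m c) = 0} := fun x hx => Set.mem_iUnion.2 (h x hx)
  have h2 : stdGaussian E (⋃ c, {x | inner ℝ x (m c) = 0}) = 0 :=
    measure_iUnion_null fun c => stdGaussian_hyperplane_eq_zero (hm c) 0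
  exact (hU.measure_pos (stdGaussian E) hne).ne' (measure_mono_null h1 h2)

variable {ι : Type*} {v : ι → E}

/-- Positive coefficients put `v b` and `v c` on the same side of `v a`, so one of them lies on the
segment from `v a` to the other. A linear functional cannot have its strict maximum there. -/
theorem not_collinear_of_strict_maximizers_of_pos
    (hv : ∀ i, ∃ p, ∀ l, l ≠ i → inner ℝ p (v l) < inner ℝ p (v i)) {a b c : ι} (hab : a ≠ b)
    (hac : a ≠ c) (hbc : b ≠ c) {α β : ℝ} (hα : 0 < α) (hβ : 0 < β) :
    α • (v a - v c) ≠ β • (v a - v b) := by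
  intro h
  have key : ∀ p : E, α * (inner ℝ p (v a) - inner ℝ p (v c)) =
      β * (inner ℝ p (v a) - inner ℝ p (v b)) := by
    intro p
    have := congrArg (fun x => inner ℝ p x) h
    simpa only [inner_smul_right, inner_sub_right] using this
  rcases le_total β α with hle | hle
  · obtain ⟨p, hp⟩ := hv c
    nlinarith [key p, mul_pos hβ (sub_pos.2 (hp b hbc)),
      mul_nonneg (sub_nonneg.2 hle) (sub_pos.2 (hp a hac)).le]
  · obtain ⟨p, hp⟩ := hv b
    nlinarith [key p, mul_pos hα (sub_pos.2 (hp c hbc.symm)),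
      mul_nonneg (sub_nonneg.2 hle) (sub_pos.2 (hp a hab)).le]

/-- A functional maximized strictly at `v a` is positive on both differences, which forces `β` to
have the sign of `α`. What remains is the case of positive coefficients, up to a common change of
sign. -/
theorem not_collinear_of_strict_maximizers
    (hv : ∀ i, ∃ p, ∀ l, l ≠ i → inner ℝ p (v l) < inner ℝ p (v i)) {a b c : ι} (hab : a ≠ b)
    (hac : a ≠ c) (hbc : b ≠ c) {α β : ℝ} (hα : α ≠ 0) :
    α • (v a - v c) ≠ β • (v a - v b) := by
  intro h
  obtain ⟨p, hp⟩ := hv a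
  have key : α * (inner ℝ p (v a) - inner ℝ p (v c)) =
      β * (inner ℝ p (v a) - inner ℝ p (v b)) := by
    have := congrArg (fun x => inner ℝ p x) h
    simpa only [inner_smul_right, inner_sub_right] using this
  have hb := sub_pos.2 (hp b hab.symm)
  have hc := sub_pos.2 (hp c hac.symm)
  rcases lt_or_gt_of_ne hα with hα | hα
  · have hβ : β < 0 := by
      by_contra! hβ
      nlinarith [mul_nonneg hβ hb.le, mul_neg_of_neg_of_pos hα hc]
    refine not_collinear_of_strict_maximizers_of_pos hv hab hac hbc (neg_pos.2 hα) (neg_pos.2 hβ) ?_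
    rw [neg_smul, neg_smul, h]
  · have hβ : 0 < β := by
      by_contra! hβ
      nlinarith [mul_nonneg (neg_nonneg.2 hβ) hb.le, mul_pos hα hc]
    exact not_collinear_of_strict_maximizers_of_pos hv hab hac hbc hα hβ h

/-- The graph of the polytope spanned by finitely many points in convex position is connected:
every proper nonempty set of vertices is left by an edge. -/
theorem exists_edge_of_strict_maximizers [FiniteDimensional ℝ E] [Finite ι]
    (hv : ∀ i, ∃ p, ∀ l, l ≠ i → inner ℝ p (v l) < inner ℝ p (v i)) {S : Set ι} {i₀ j₀ : ι}
    (hi₀ : i₀ ∈ S) (hj₀ : j₀ ∉ S) :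
    ∃ i ∈ S, ∃ j ∉ S, ∃ w, inner ℝ w (v i) = inner ℝ w (v j) ∧
      ∀ l, l ≠ i → l ≠ j → inner ℝ w (v l) < inner ℝ w (v i) := by
  borelize E
  have hopen : ∀ i, IsOpen {p : E | ∀ l, l ≠ i → inner ℝ p (v l) < inner ℝ p (v i)} := by
    intro i
    simp only [Set.ofPred_forall]
    exact isOpen_iInter_of_finite fun l => isOpen_iInter_of_finite fun _ =>
      isOpen_lt (by fun_prop) (by fun_prop)
  have hinj : ∀ a b, a ≠ b → v a - v b ≠ 0 := by
    intro a b hab h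
    obtain ⟨p, hp⟩ := hv a
    have := hp b hab.symm
    rw [sub_eq_zero.1 h] at this
    exact lt_irrefl _ this
  -- The edge is found on the segment from `p`, where `i₀` wins, to `q`, where `j₀` wins. A generic
  -- `p` separates the values of all the vectors.
  obtain ⟨p, hp, hp'⟩ := (hopen i₀).exists_forall_inner_ne_zero (hv i₀)
    (κ := {c : ι × ι // c.1 ≠ c.2}) (m := fun c => v c.1.1 - v c.1.2)
    (fun c => hinj _ _ c.2)
  have hpne : ∀ a b, a ≠ b → inner ℝ p (v a - v b) ≠ 0 := fun a b hab => hp' ⟨(a, b), hab⟩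
  -- This choice of `q` prevents triple ties on the segment: a tie of `a`, `b`, `c` there would make
  -- `q` orthogonal to the displayed vector, which is nonzero because no three vertices are
  -- collinear.
  obtain ⟨q, hq, hq'⟩ := (hopen j₀).exists_forall_inner_ne_zero (hv j₀)
    (κ := {c : ι × ι × ι // c.1 ≠ c.2.1 ∧ c.1 ≠ c.2.2 ∧ c.2.1 ≠ c.2.2})
    (m := fun c => inner ℝ p (v c.1.1 - v c.1.2.1) • (v c.1.1 - v c.1.2.2) -
      inner ℝ p (v c.1.1 - v c.1.2.2) • (v c.1.1 - v c.1.2.1))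
    (fun c => sub_ne_zero.2 (not_collinear_of_strict_maximizers hv c.2.1 c.2.2.1 c.2.2.2
      (hpne _ _ c.2.1)))
  let x : ℝ → E := fun t => (1 - t) • p + t • q
  have hx : Continuous x := by fun_prop
  let T : Set ι → Set ℝ := fun R => ⋃ i, ⋃ (_ : i ∈ R), ⋂ l,
    {t | inner ℝ (x t) (v l) ≤ inner ℝ (x t) (v i)}
  have hT : ∀ R, IsClosed (T R) := fun R =>
    isClosed_iUnion_of_finite fun i => isClosed_iUnion_of_finite fun _ =>
      isClosed_iInter fun l => isClosed_le (by fun_prop) (by fun_prop)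
  have hTmem : ∀ R t, t ∈ T R ↔
      ∃ i ∈ R, ∀ l, inner ℝ (x t) (v l) ≤ inner ℝ (x t) (v i) := by
    intro R t; simp [T]
  have : Nonempty ι := ⟨i₀⟩
  -- The parameters with a maximizer in `S` and those with one outside form two closed sets covering
  -- the interval and each meeting it. By connectedness they intersect, so a vertex of `S` ties with
  -- one outside.
  obtain ⟨t, ht, htS, htS'⟩ := isPreconnected_closed_iff.1 (isPreconnected_Icc (a := (0 : ℝ))
    (b := 1)) (T S) (T Sᶜ) (hT _) (hT _)
    (by
      intro t _
      obtain ⟨i, hi⟩ := Finite.exists_max (fun l => inner ℝ (x t) (v l))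
      by_cases hiS : i ∈ S
      · exact Or.inl ((hTmem _ _).2 ⟨i, hiS, hi⟩)
      · exact Or.inr ((hTmem _ _).2 ⟨i, hiS, hi⟩))
    ⟨0, by simp, (hTmem _ _).2 ⟨i₀, hi₀, fun l => by
      rcases eq_or_ne l i₀ with rfl | hl
      · rfl
      · simpa [x] using (hp l hl).le⟩⟩
    ⟨1, by simp, (hTmem _ _).2 ⟨j₀, hj₀, fun l => by
      rcases eq_or_ne l j₀ with rfl | hl
      · rfl
      · simpa [x] using (hq l hl).le⟩⟩
  obtain ⟨i, hiS, hi⟩ := (hTmem _ _).1 htS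
  obtain ⟨j, hjS, hj⟩ := (hTmem _ _).1 htS'
  have hij : i ≠ j := fun h => hjS (h ▸ hiS)
  have hw := le_antisymm (hj i) (hi j)
  refine ⟨i, hiS, j, hjS, x t, hw, fun l hli hlj => lt_of_le_of_ne (hi l) fun heq => ?_⟩
  have h1 := hq' ⟨(i, j, l), hij, hli.symm, hlj.symm⟩
  have h2 := hpne i j hij
  simp only [x, inner_add_left, inner_smul_left, conj_trivial] at hw heq
  simp only [inner_sub_right, inner_smul_right] at h1 h2
  have ht0 : t ≠ 0 := by
    rintro rfl
    exact h2 (by linarith)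
  refine h1 (mul_left_cancel₀ ht0 ?_)
  -- Eliminating the terms with factor `1 - t` from the two ties leaves `t` times the expression
  -- that the choice of `q` keeps nonzero.
  linear_combination (inner ℝ p (v i) - inner ℝ p (v l)) * (-hw) -
    (inner ℝ p (v i) - inner ℝ p (v j)) * heq

end Adjacency

/-! ### Analyticity of Gaussian averages along lines, and off-centre half-spaces. -/

section Analyticity

variable {E : Type*} [NormedAddCommGroup E] [InnerProductSpace ℝ E] [FiniteDimensional ℝ E]
  [MeasurableSpace E] [BorelSpace E]

/-- Gaussian averages of a set are real-analytic along lines. -/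
theorem analyticOnNhd_integral_indicator_line {A : Set E} (hA : MeasurableSet A) (c w : E) {s : ℝ}
    (hs : s ≠ 0) :
    AnalyticOnNhd ℝ (fun τ : ℝ => ∫ z, A.indicator (fun _ => (1 : ℝ)) (c + τ • w + s • z)
      ∂(stdGaussian E)) Set.univ := by
  set D : Set E := {z | c + s • z ∈ A} with hD
  have hDm : MeasurableSet D := (by fun_prop : Measurable fun z : E => c + s • z) hA
  have hset : integrableExpSet (fun z => inner ℝ z w) ((stdGaussian E).restrict D) = Set.univ :=
    Set.eq_univ_of_forall fun t => (integrable_exp_inner_stdGaussian w t).restrict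
  have hmgf : AnalyticOnNhd ℝ (mgf (fun z => inner ℝ z w) ((stdGaussian E).restrict D))
      Set.univ := by
    have := analyticOnNhd_mgf (X := fun z => inner ℝ z w) (μ := (stdGaussian E).restrict D)
    rwa [hset, interior_univ] at this
  -- Translating `z` by `(τ / s) w` and applying Cameron-Martin removes `τ` from the set. It
  -- survives only in a Gaussian factor and in a moment generating function that is finite on the
  -- whole line.
  have heq : ∀ τ : ℝ, ∫ z, A.indicator (fun _ => (1 : ℝ)) (c + τ • w + s • z) ∂(stdGaussian E) =
      Real.exp (-((τ / s) ^ 2 * ‖w‖ ^ 2 / 2)) *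
        mgf (fun z => inner ℝ z w) ((stdGaussian E).restrict D) (τ / s) := by
    intro τ
    have h1 : ∀ z, A.indicator (fun _ => (1 : ℝ)) (c + τ • w + s • z) =
        D.indicator (fun _ => (1 : ℝ)) (z + (τ / s) • w) := by
      intro z
      have : c + s • (z + (τ / s) • w) = c + τ • w + s • z := by
        rw [smul_add, smul_smul, mul_div_cancel₀ _ hs]
        abel
      have hiff : z + (τ / s) • w ∈ D ↔ c + τ • w + s • z ∈ A := by
        rw [← this]; rfl
      by_cases h : c + τ • w + s • z ∈ A
      · rw [Set.indicator_of_mem h, Set.indicator_of_mem (hiff.2 h)]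
      · rw [Set.indicator_of_notMem h, Set.indicator_of_notMem (mt hiff.1 h)]
    simp_rw [h1]
    rw [integral_add_right_stdGaussian, mgf, ← integral_indicator hDm, ← integral_const_mul]
    refine integral_congr_ae (Filter.Eventually.of_forall fun z => ?_)
    by_cases hz : z ∈ D
    · simp only [hz, Set.indicator_of_mem, mul_one, ← Real.exp_add, inner_smul_right, norm_smul,
        mul_pow, Real.norm_eq_abs, sq_abs]
      ring_nf
    · simp [hz]
  simp_rw [heq]
  intro τ _
  have hdiv : AnalyticAt ℝ (fun τ : ℝ => τ / s) τ := analyticAt_id.div_const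
  refine AnalyticAt.mul ?_ (AnalyticAt.fun_comp (hmgf _ (Set.mem_univ _)) hdiv)
  exact (((hdiv.pow 2).mul analyticAt_const).div_const).neg.rexp

theorem measurable_realSign : Measurable Real.sign :=
  Measurable.ite measurableSet_Iio measurable_const
    (Measurable.ite measurableSet_Ioi measurable_const measurable_const)

theorem integrable_realSign {f : E → ℝ} (hf : Measurable f) :
    Integrable (fun z => Real.sign (f z)) (stdGaussian E) := by
  refine Integrable.of_bound (measurable_realSign.comp hf).aestronglyMeasurable 1
    (Filter.Eventually.of_forall fun z => ?_)
  rcases Real.sign_apply_eq (f z) with h | h | h <;> simp [h]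

/-- A half-space which does not contain the origin has Gaussian measure less than one half. -/
theorem integral_sign_inner_sub_ne_zero {u : E} {s θ : ℝ} (hθ : 0 < θ) :
    ∫ z, Real.sign (s * inner ℝ z u - θ) ∂(stdGaussian E) ≠ 0 := by
  intro h
  -- Reflection in the origin replaces `-θ` by `θ`. The two integrands then differ by 2 on an open
  -- strip around the origin and are ordered everywhere, so their integrals cannot both vanish.
  have hneg : ∫ z, Real.sign (s * inner ℝ z u + θ) ∂(stdGaussian E) = 0 := by
    have hm : Measurable fun z : E => Real.sign (s * inner ℝ z u - θ) :=
      measurable_realSign.comp (by fun_prop)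
    rw [← stdGaussian_map_neg, integral_map measurable_neg.aemeasurable
      hm.aestronglyMeasurable] at h
    have h1 : ∀ z : E, Real.sign (s * inner ℝ (-z) u - θ) = -Real.sign (s * inner ℝ z u + θ) := by
      intro z
      rw [← Real.sign_neg, inner_neg_left]
      ring_nf
    simp_rw [h1] at h
    rwa [integral_neg, neg_eq_zero] at h
  have hint := integral_sub (integrable_realSign (E := E)
    (f := fun z => s * inner ℝ z u + θ) (by fun_prop))
    (integrable_realSign (f := fun z => s * inner ℝ z u - θ) (by fun_prop))
  rw [h, hneg, sub_zero] at hint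
  rw [integral_eq_zero_iff_of_nonneg] at hint
  · have hU : IsOpen {z : E | |s * inner ℝ z u| < θ} := isOpen_lt (by fun_prop) (by fun_prop)
    have hpos := hU.measure_pos (stdGaussian E) ⟨0, by simpa using hθ⟩
    refine hpos.ne' (measure_mono_null ?_ hint)
    intro z hz
    have hz' : |s * inner ℝ z u| < θ := hz
    rw [abs_lt] at hz'
    have e1 : Real.sign (s * inner ℝ z u + θ) = 1 := Real.sign_of_pos (by linarith)
    have e2 : Real.sign (s * inner ℝ z u - θ) = -1 := Real.sign_of_neg (by linarith)
    change ¬ Real.sign (s * inner ℝ z u + θ) - Real.sign (s * inner ℝ z u - θ) = 0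
    rw [e1, e2]
    norm_num
  · intro z
    simp only [Pi.zero_apply]
    rcases lt_trichotomy (s * inner ℝ z u - θ) 0 with h1 | h1 | h1
    · rw [Real.sign_of_neg h1]
      rcases Real.sign_apply_eq (s * inner ℝ z u + θ) with h | h | h <;> norm_num [h]
    · rw [h1, Real.sign_zero, Real.sign_of_pos (by linarith)]; norm_num
    · rw [Real.sign_of_pos h1, Real.sign_of_pos (by linarith)]; norm_num
  · exact (integrable_realSign (by fun_prop)).sub (integrable_realSign (by fun_prop))

end Analyticity
end

noncomputable section

/-! ### Stationary flat partitions. -/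

section Flat

variable {n k : ℕ} {A : Fin k → Set (EuclideanSpace ℝ (Fin n))} {y : EuclideanSpace ℝ (Fin n)}
  {v : Fin k → EuclideanSpace ℝ (Fin n)} {ρ : ℝ}

theorem mem_ownPart_iff_of_flat
    (hmem : ∀ i x, x ∈ A i ↔ ∀ l, inner ℝ (x - y) (v l) ≤ inner ℝ (x - y) (v i))
    {i : Fin k} {x : EuclideanSpace ℝ (Fin n)} :
    x ∈ ownPart A i ↔ ∀ l, l ≠ i → inner ℝ (x - y) (v l) < inner ℝ (x - y) (v i) := by
  rw [mem_ownPart]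
  constructor
  · rintro ⟨h1, h2⟩ l hl
    have h3 := h2 l hl
    rw [hmem] at h1 h3
    push Not at h3
    obtain ⟨m, hm⟩ := h3
    exact hm.trans_le (h1 m)
  · intro h
    refine ⟨(hmem i x).2 fun l => ?_, fun l hl hx => ?_⟩
    · rcases eq_or_ne l i with rfl | hl
      · rfl
      · exact (h l hl).le
    · exact (h l hl).not_ge ((hmem l x).1 hx i)

/-- With an empty own part, `A i` would be covered by its null overlaps. For a flat partition,
positive volume thus yields a strict maximizer for every index, so the `v i` are in convex position.
-/
theorem ownPart_nonempty (hA : IsGaussianPartition A) {i : Fin k}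
    (hpos : 0 < (stdGaussian (EuclideanSpace ℝ (Fin n))).real (A i)) : (ownPart A i).Nonempty := by
  by_contra hne
  rw [Set.not_nonempty_iff_eq_empty] at hne
  have hsub : A i ⊆ ⋃ l, ⋃ (_ : i ≠ l), A i ∩ A l := by
    intro x hx
    by_contra hx'
    have : x ∈ ownPart A i := mem_ownPart.2 ⟨hx, fun l hl hxl => hx' <|
      Set.mem_iUnion.2 ⟨l, Set.mem_iUnion.2 ⟨hl.symm, hx, hxl⟩⟩⟩
    rw [hne] at this
    exact this
  have h0 : stdGaussian (EuclideanSpace ℝ (Fin n)) (A i) = 0 :=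
    measure_mono_null hsub (measure_iUnion_null fun l => measure_iUnion_null fun h =>
      hA.null_inter i l h)
  rw [Measure.real, h0] at hpos
  exact lt_irrefl _ hpos

theorem isOpen_ownPart_of_flat
    (hmem : ∀ i x, x ∈ A i ↔ ∀ l, inner ℝ (x - y) (v l) ≤ inner ℝ (x - y) (v i)) (i : Fin k) :
    IsOpen (ownPart A i) := by
  have : ownPart A i = ⋂ l, ⋂ (_ : l ≠ i),
      {x | inner ℝ (x - y) (v l) < inner ℝ (x - y) (v i)} := by
    ext x
    rw [mem_ownPart_iff_of_flat hmem]
    simp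
  rw [this]
  exact isOpen_iInter_of_finite fun l => isOpen_iInter_of_finite fun _ =>
    isOpen_lt (by fun_prop) (by fun_prop)

/-- Each cone of a flat partition is the closure of its interior, in measure. -/
theorem ball_inter_ownPart_pos_of_flat
    (hmem : ∀ i x, x ∈ A i ↔ ∀ l, inner ℝ (x - y) (v l) ≤ inner ℝ (x - y) (v i)) {i : Fin k}
    (hne : (ownPart A i).Nonempty) {x : EuclideanSpace ℝ (Fin n)} (hx : x ∈ A i) {r : ℝ}
    (hr : 0 < r) :
    0 < (stdGaussian (EuclideanSpace ℝ (Fin n))).real (Metric.ball x r ∩ ownPart A i) := by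
  obtain ⟨c, hc⟩ := hne
  rw [mem_ownPart_iff_of_flat hmem] at hc
  rw [hmem] at hx
  -- Adding a small multiple of a strictly interior direction to a point of the closed cone makes
  -- all its inequalities strict.
  have hlim : Filter.Tendsto (fun ε : ℝ => x + ε • (c - y)) (nhdsWithin 0 (Set.Ioi 0))
      (nhds x) := by
    have : Continuous fun ε : ℝ => x + ε • (c - y) := by fun_prop
    have h := this.tendsto 0
    rw [zero_smul, add_zero] at h
    exact h.mono_left nhdsWithin_le_nhds
  have hpos : ∀ᶠ ε in nhdsWithin (0 : ℝ) (Set.Ioi 0), 0 < ε := self_mem_nhdsWithin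
  obtain ⟨ε, hε, hε0⟩ := ((hlim.eventually (Metric.ball_mem_nhds x hr)).and hpos).exists
  refine ENNReal.toReal_pos ?_ (measure_ne_top _ _)
  refine ((Metric.isOpen_ball.inter (isOpen_ownPart_of_flat hmem i)).measure_pos _
    ⟨x + ε • (c - y), hε, (mem_ownPart_iff_of_flat hmem).2 fun l hl => ?_⟩).ne'
  have e : x + ε • (c - y) - y = (x - y) + ε • (c - y) := by abel
  rw [e]
  simp only [inner_add_left, inner_smul_left, conj_trivial]
  have := mul_lt_mul_of_pos_left (hc l hl) hε0
  linarith [hx l]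

theorem continuous_noiseOperator_of_flat (hρ : |ρ| < 1)
    (hmeas : ∀ i, MeasurableSet (A i))
    (hmem : ∀ i x, x ∈ A i ↔ ∀ l, inner ℝ (x - y) (v l) ≤ inner ℝ (x - y) (v i))
    (hinj : ∀ i j, i ≠ j → v i ≠ v j) (i : Fin k) :
    Continuous (noiseOperator ρ ((A i).indicator (fun _ => (1 : ℝ)))) := by
  have hs : 0 < Real.sqrt (1 - ρ ^ 2) := Real.sqrt_pos.2 (one_sub_sq_pos_of_abs_lt_one hρ)
  rw [continuous_iff_continuousAt]
  intro x
  unfold noiseOperator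
  set s := Real.sqrt (1 - ρ ^ 2)
  refine continuousAt_of_dominated (bound := fun _ => 1) (Filter.Eventually.of_forall fun x' => ?_)
    (Filter.Eventually.of_forall fun x' => Filter.Eventually.of_forall fun z => ?_)
    (integrable_const _) ?_
  · exact ((measurable_const.indicator (hmeas i)).comp (by fun_prop)).aestronglyMeasurable
  · by_cases h : ρ • x' + s • z ∈ A i <;> simp [h]
  -- The integrand can jump only when `ρ x + s z` lies on a bounding hyperplane of the cone, which
  -- happens for a null set of `z`.
  have hnull : ∀ᵐ z ∂(stdGaussian (EuclideanSpace ℝ (Fin n))), ∀ l, l ≠ i →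
      inner ℝ z (v l - v i) ≠ -inner ℝ (ρ • x - y) (v l - v i) / s := by
    rw [ae_all_iff]
    intro l
    by_cases hl : l = i
    · simp [hl]
    · filter_upwards [measure_eq_zero_iff_ae_notMem.1 (stdGaussian_hyperplane_eq_zero
        (sub_ne_zero.2 (hinj l i hl)) (-inner ℝ (ρ • x - y) (v l - v i) / s))] with z hz _
      exact hz
  filter_upwards [hnull] with z hz
  have hne : ∀ l, l ≠ i → inner ℝ (ρ • x + s • z - y) (v l) ≠
      inner ℝ (ρ • x + s • z - y) (v i) := by
    intro l hl h
    apply hz l hl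
    have e : ρ • x + s • z - y = (ρ • x - y) + s • z := by abel
    rw [e] at h
    rw [eq_div_iff hs.ne']
    simp only [inner_add_left (ρ • x - y), inner_smul_left, conj_trivial] at h
    simp only [inner_sub_right]
    linarith
  have hc : ∀ l, ContinuousAt (fun x' => inner ℝ (ρ • x' + s • z - y) (v l)) x := fun l => by
    fun_prop
  refine continuousAt_const.congr
    (f := fun _ => (A i).indicator (fun _ => (1 : ℝ)) (ρ • x + s • z)) ?_
  by_cases h : ρ • x + s • z ∈ A i
  · have hlt : ∀ l, l ≠ i → ∀ᶠ x' in nhds x,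
        inner ℝ (ρ • x' + s • z - y) (v l) < inner ℝ (ρ • x' + s • z - y) (v i) := fun l hl =>
      (hc l).eventually_lt (hc i) (lt_of_le_of_ne ((hmem _ _).1 h l) (hne l hl))
    have hall : ∀ᶠ x' in nhds x, ∀ l, l ≠ i →
        inner ℝ (ρ • x' + s • z - y) (v l) < inner ℝ (ρ • x' + s • z - y) (v i) := by
      rw [Filter.eventually_all]
      intro l
      by_cases hl : l = i
      · exact Filter.Eventually.of_forall fun _ h' => absurd hl h'
      · exact (hlt l hl).mono fun _ h' _ => h'
    filter_upwards [hall] with x' hx'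
    have h' : ρ • x' + s • z ∈ A i := (hmem _ _).2 fun l => by
      rcases eq_or_ne l i with rfl | hl
      · rfl
      · exact (hx' l hl).le
    rw [Set.indicator_of_mem h, Set.indicator_of_mem h']
  · have h1 := h
    rw [hmem] at h1
    push Not at h1
    obtain ⟨l, hl⟩ := h1
    filter_upwards [(hc i).eventually_lt (hc l) hl] with x' hx'
    have h' : ρ • x' + s • z ∉ A i := fun h' => ((hmem _ _).1 h' l).not_gt hx'
    rw [Set.indicator_of_notMem h, Set.indicator_of_notMem h']

/-- Far along an edge direction `w` between the cones `i` and `j`, on the opposite side neither of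
the cones is met, and on the positive side they look like two complementary half-spaces. -/
theorem tendsto_indicator_sub_indicator_of_flat
    (hmem : ∀ i x, x ∈ A i ↔ ∀ l, inner ℝ (x - y) (v l) ≤ inner ℝ (x - y) (v i))
    {i j : Fin k} {w : EuclideanSpace ℝ (Fin n)} (hw : inner ℝ w (v i) = inner ℝ w (v j))
    (hwl : ∀ l, l ≠ i → l ≠ j → inner ℝ w (v l) < inner ℝ w (v i))
    (hk : ∃ l, l ≠ i ∧ l ≠ j) (x : EuclideanSpace ℝ (Fin n)) :
    (∀ᶠ τ : ℝ in Filter.atBot, (A i).indicator (fun _ => (1 : ℝ)) (x + τ • w) -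
      (A j).indicator (fun _ => (1 : ℝ)) (x + τ • w) = 0) ∧
    (∀ᶠ τ : ℝ in Filter.atTop, (A i).indicator (fun _ => (1 : ℝ)) (x + τ • w) -
      (A j).indicator (fun _ => (1 : ℝ)) (x + τ • w) =
        Real.sign (inner ℝ (x - y) (v i - v j))) := by
  have hin : ∀ (τ : ℝ) l, inner ℝ (x + τ • w - y) (v l) =
      inner ℝ (x - y) (v l) + τ * inner ℝ w (v l) := by
    intro τ l
    have e : x + τ • w - y = (x - y) + τ • w := by abel
    rw [e, inner_add_left, inner_smul_left]; rfl
  -- Far in the direction `-w`, any index with a smaller product with `w` beats `m`. A third index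
  -- therefore excludes both `i` and `j`.
  have hbot : ∀ m l, inner ℝ w (v l) < inner ℝ w (v m) → ∀ᶠ τ : ℝ in Filter.atBot,
      x + τ • w ∉ A m := by
    intro m l hlm
    have hd := sub_pos.2 hlm
    filter_upwards [Filter.eventually_lt_atBot
      ((inner ℝ (x - y) (v l) - inner ℝ (x - y) (v m)) /
        (inner ℝ w (v m) - inner ℝ w (v l)))] with τ hτ hx
    have := (hmem _ _).1 hx l
    rw [hin, hin] at this
    rw [lt_div_iff₀ hd] at hτ
    linarith
  constructor
  · obtain ⟨l, hli, hlj⟩ := hk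
    filter_upwards [hbot i l (hwl l hli hlj), hbot j l (hw ▸ hwl l hli hlj)] with τ h1 h2
    rw [Set.indicator_of_notMem h1, Set.indicator_of_notMem h2, sub_zero]
  · have htop : ∀ᶠ τ : ℝ in Filter.atTop, ∀ l, l ≠ i → l ≠ j →
        inner ℝ (x + τ • w - y) (v l) < inner ℝ (x + τ • w - y) (v i) ∧
        inner ℝ (x + τ • w - y) (v l) < inner ℝ (x + τ • w - y) (v j) := by
      rw [Filter.eventually_all]
      intro l
      by_cases hli : l = i
      · exact Filter.Eventually.of_forall fun _ h => absurd hli h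
      by_cases hlj : l = j
      · exact Filter.Eventually.of_forall fun _ _ h => absurd hlj h
      have hd := sub_pos.2 (hwl l hli hlj)
      filter_upwards [Filter.eventually_gt_atTop
        ((inner ℝ (x - y) (v l) - inner ℝ (x - y) (v i)) /
          (inner ℝ w (v i) - inner ℝ w (v l))), Filter.eventually_gt_atTop
        ((inner ℝ (x - y) (v l) - inner ℝ (x - y) (v j)) /
          (inner ℝ w (v i) - inner ℝ w (v l)))] with τ h1 h2 _ _
      rw [div_lt_iff₀ hd] at h1 h2
      rw [hin, hin, hin, ← hw]
      constructor <;> linarith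
    have hi : ∀ τ : ℝ, (∀ l, l ≠ i → l ≠ j →
        inner ℝ (x + τ • w - y) (v l) < inner ℝ (x + τ • w - y) (v i) ∧
        inner ℝ (x + τ • w - y) (v l) < inner ℝ (x + τ • w - y) (v j)) →
        (x + τ • w ∈ A i ↔ inner ℝ (x - y) (v j) ≤ inner ℝ (x - y) (v i)) ∧
        (x + τ • w ∈ A j ↔ inner ℝ (x - y) (v i) ≤ inner ℝ (x - y) (v j)) := by
      intro τ hτ
      rw [hmem, hmem]
      refine ⟨⟨fun h => ?_, fun h l => ?_⟩, ⟨fun h => ?_, fun h l => ?_⟩⟩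
      · have := h j
        rw [hin, hin, hw] at this
        linarith
      · by_cases hli : l = i
        · rw [hli]
        by_cases hlj : l = j
        · rw [hlj, hin, hin, hw]; linarith
        · exact (hτ l hli hlj).1.le
      · have := h i
        rw [hin, hin, hw] at this
        linarith
      · by_cases hlj : l = j
        · rw [hlj]
        by_cases hli : l = i
        · rw [hli, hin, hin, hw]; linarith
        · exact (hτ l hli hlj).2.le
    filter_upwards [htop] with τ hτ
    obtain ⟨h1, h2⟩ := hi τ hτ
    rw [inner_sub_right]
    rcases lt_trichotomy (inner ℝ (x - y) (v i)) (inner ℝ (x - y) (v j)) with h | h | h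
    · rw [Set.indicator_of_notMem (mt h1.1 h.not_ge), Set.indicator_of_mem (h2.2 h.le),
        Real.sign_of_neg (sub_neg.2 h), zero_sub]
    · rw [Set.indicator_of_mem (h1.2 h.ge), Set.indicator_of_mem (h2.2 h.le), h, sub_self,
        sub_self, Real.sign_zero]
    · rw [Set.indicator_of_mem (h1.2 h.le), Set.indicator_of_notMem (mt h2.1 h.not_ge),
        Real.sign_of_pos (sub_pos.2 h), sub_zero]

/-- Stationarity on the ray from the apex extends by analyticity to the whole line, and the two
conclusions come from comparing the value at the apex with the limits at the two ends. -/
theorem noiseOperator_eq_and_integral_sign_eq_zero_of_edge (hρ : |ρ| < 1) (hρ0 : ρ ≠ 0)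
    (hmeas : ∀ i, MeasurableSet (A i))
    (hmem : ∀ i x, x ∈ A i ↔ ∀ l, inner ℝ (x - y) (v l) ≤ inner ℝ (x - y) (v i))
    {i j : Fin k} {w : EuclideanSpace ℝ (Fin n)} (hw : inner ℝ w (v i) = inner ℝ w (v j))
    (hwl : ∀ l, l ≠ i → l ≠ j → inner ℝ w (v l) < inner ℝ w (v i))
    (hk : ∃ l, l ≠ i ∧ l ≠ j)
    (hconst : ∀ p ∈ A i ∩ A j, ∀ q ∈ A i ∩ A j,
      noiseOperator ρ ((A i).indicator (fun _ => (1 : ℝ))) p -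
        noiseOperator ρ ((A j).indicator (fun _ => (1 : ℝ))) p =
      noiseOperator ρ ((A i).indicator (fun _ => (1 : ℝ))) q -
        noiseOperator ρ ((A j).indicator (fun _ => (1 : ℝ))) q) :
    noiseOperator ρ ((A i).indicator (fun _ => (1 : ℝ))) y =
      noiseOperator ρ ((A j).indicator (fun _ => (1 : ℝ))) y ∧
    ∫ z, Real.sign (Real.sqrt (1 - ρ ^ 2) * inner ℝ z (v i - v j) -
      (1 - ρ) * inner ℝ y (v i - v j)) ∂(stdGaussian (EuclideanSpace ℝ (Fin n))) = 0 := by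
  have hs : 0 < Real.sqrt (1 - ρ ^ 2) := Real.sqrt_pos.2 (one_sub_sq_pos_of_abs_lt_one hρ)
  set s := Real.sqrt (1 - ρ ^ 2) with hs_def
  set h : ℝ → ℝ := fun τ =>
    ∫ z, (A i).indicator (fun _ => (1 : ℝ)) (ρ • y + τ • w + s • z)
        ∂(stdGaussian (EuclideanSpace ℝ (Fin n))) -
      ∫ z, (A j).indicator (fun _ => (1 : ℝ)) (ρ • y + τ • w + s • z)
        ∂(stdGaussian (EuclideanSpace ℝ (Fin n))) with hh
  have hF : ∀ t : ℝ, h (ρ * t) =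
      noiseOperator ρ ((A i).indicator (fun _ => (1 : ℝ))) (y + t • w) -
        noiseOperator ρ ((A j).indicator (fun _ => (1 : ℝ))) (y + t • w) := by
    intro t
    simp only [hh, noiseOperator, smul_add, smul_smul, ← hs_def]
  have hmem' : ∀ t : ℝ, 0 ≤ t → y + t • w ∈ A i ∩ A j := by
    intro t ht
    have hle : ∀ l, inner ℝ w (v l) ≤ inner ℝ w (v i) := by
      intro l
      by_cases hli : l = i
      · rw [hli]
      by_cases hlj : l = j
      · rw [hlj, hw]
      exact (hwl l hli hlj).le
    constructor
    · rw [hmem]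
      intro l
      rw [add_sub_cancel_left, inner_smul_left, inner_smul_left]
      exact mul_le_mul_of_nonneg_left (hle l) ht
    · rw [hmem]
      intro l
      rw [add_sub_cancel_left, inner_smul_left, inner_smul_left, ← hw]
      exact mul_le_mul_of_nonneg_left (hle l) ht
  have hanalytic : AnalyticOnNhd ℝ h Set.univ :=
    (analyticOnNhd_integral_indicator_line (hmeas i) (ρ • y) w hs.ne').sub
      (analyticOnNhd_integral_indicator_line (hmeas j) (ρ • y) w hs.ne')
  have hconst' : h = fun _ => h 0 := by
    -- Moving by `t w` shifts the argument of the averages by `ρ t w`, so the base point `ρ`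
    -- corresponds to `t = 1`, interior to the ray. This works for either sign of `ρ`.
    refine hanalytic.eq_of_eventuallyEq (fun _ _ => analyticAt_const) (z₀ := ρ) ?_
    have hlim : Filter.Tendsto (fun τ : ℝ => τ / ρ) (nhds ρ) (nhds (ρ / ρ)) :=
      (continuous_id.div_const ρ).tendsto ρ
    rw [div_self hρ0] at hlim
    filter_upwards [hlim.eventually (lt_mem_nhds one_pos)] with τ hτ
    have e1 := hF (τ / ρ)
    have e0 := hF 0
    rw [mul_div_cancel₀ _ hρ0] at e1
    rw [mul_zero] at e0
    rw [e1, e0]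
    exact hconst _ (hmem' _ hτ.le) _ (hmem' _ le_rfl)
  have hint : ∀ m (τ : ℝ), Integrable (fun z => (A m).indicator (fun _ => (1 : ℝ))
      (ρ • y + τ • w + s • z)) (stdGaussian (EuclideanSpace ℝ (Fin n))) := by
    intro m τ
    refine Integrable.of_bound
      ((measurable_const.indicator (hmeas m)).comp (by fun_prop)).aestronglyMeasurable 1
      (Filter.Eventually.of_forall fun z => ?_)
    by_cases hz : ρ • y + τ • w + s • z ∈ A m <;> simp [hz]
  have hsub : ∀ τ, h τ = ∫ z, ((A i).indicator (fun _ => (1 : ℝ)) (ρ • y + τ • w + s • z) -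
      (A j).indicator (fun _ => (1 : ℝ)) (ρ • y + τ • w + s • z))
        ∂(stdGaussian (EuclideanSpace ℝ (Fin n))) := fun τ =>
    (integral_sub (hint i τ) (hint j τ)).symm
  have hbound : ∀ (τ : ℝ) z, ‖(A i).indicator (fun _ => (1 : ℝ)) (ρ • y + τ • w + s • z) -
      (A j).indicator (fun _ => (1 : ℝ)) (ρ • y + τ • w + s • z)‖ ≤ 1 := by
    intro τ z
    by_cases h1 : ρ • y + τ • w + s • z ∈ A i <;> by_cases h2 : ρ • y + τ • w + s • z ∈ A j <;>
      simp [h1, h2]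
  have hswap : ∀ (τ : ℝ) (z : EuclideanSpace ℝ (Fin n)),
      ρ • y + τ • w + s • z = (ρ • y + s • z) + τ • w := fun τ z => by abel
  have hlim := fun z =>
    tendsto_indicator_sub_indicator_of_flat hmem hw hwl hk (ρ • y + s • z)
  simp_rw [← hswap] at hlim
  have hlimit : ∀ (L : Filter ℝ) [L.NeBot] [L.IsCountablyGenerated]
      (φ : EuclideanSpace ℝ (Fin n) → ℝ), (∀ z, ∀ᶠ τ in L,
      (A i).indicator (fun _ => (1 : ℝ)) (ρ • y + τ • w + s • z) -
        (A j).indicator (fun _ => (1 : ℝ)) (ρ • y + τ • w + s • z) = φ z) →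
      h 0 = ∫ z, φ z ∂(stdGaussian (EuclideanSpace ℝ (Fin n))) := by
    intro L _ _ φ hφ
    have h1 : Filter.Tendsto h L (nhds (∫ z, φ z ∂(stdGaussian (EuclideanSpace ℝ (Fin n))))) := by
      rw [funext hsub]
      refine tendsto_integral_filter_of_dominated_convergence (fun _ => 1)
        (Filter.Eventually.of_forall fun τ =>
          ((hint i τ).sub (hint j τ)).aestronglyMeasurable)
        (Filter.Eventually.of_forall fun τ => Filter.Eventually.of_forall (hbound τ))
        (integrable_const _) (Filter.Eventually.of_forall fun z => ?_)
      exact tendsto_const_nhds.congr' ((hφ z).mono fun τ h => h.symm)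
    rw [hconst'] at h1
    exact tendsto_nhds_unique tendsto_const_nhds h1
  -- The end at `-∞` shows that the constant is 0; the end at `+∞` then turns this into the
  -- vanishing of the sign integral.
  have h0 : h 0 = 0 := by
    rw [hlimit Filter.atBot (fun _ => 0) fun z => (hlim z).1, integral_zero]
  constructor
  · have e0 := hF 0
    rw [mul_zero, h0, zero_smul, add_zero] at e0
    exact (sub_eq_zero.1 e0.symm)
  · rw [← h0, hlimit Filter.atTop _ fun z => (hlim z).2]
    refine integral_congr_ae (Filter.Eventually.of_forall fun z => ?_)
    have e : ρ • y + s • z - y = s • z - (1 - ρ) • y := by module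
    simp only [e]
    rw [inner_sub_left (s • z), inner_smul_left, inner_smul_left]
    rfl

/-- Adding multiples of `y` changes all the products with the `v i` equally, and multiplying by a
positive scalar preserves their order. Hence `ρ y + s z` and `z` lie in the same cones. -/
theorem volume_eq_noiseOperator_apex
    (hρ : |ρ| < 1) (hmeas : ∀ i, MeasurableSet (A i))
    (hmem : ∀ i x, x ∈ A i ↔ ∀ l, inner ℝ (x - y) (v l) ≤ inner ℝ (x - y) (v i))
    (hy : ∀ i j, inner ℝ y (v i) = inner ℝ y (v j)) (i : Fin k) :
    noiseOperator ρ ((A i).indicator (fun _ => (1 : ℝ))) y =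
      (stdGaussian (EuclideanSpace ℝ (Fin n))).real (A i) := by
  have hs : 0 < Real.sqrt (1 - ρ ^ 2) := Real.sqrt_pos.2 (one_sub_sq_pos_of_abs_lt_one hρ)
  rw [noiseOperator_indicator ρ (hmeas i)]
  congr 1
  ext z
  change ρ • y + Real.sqrt (1 - ρ ^ 2) • z ∈ A i ↔ z ∈ A i
  rw [hmem, hmem]
  refine forall_congr' fun l => ?_
  simp only [inner_sub_left, inner_add_left, inner_smul_left, conj_trivial, hy l i]
  rw [sub_le_sub_iff_right, sub_le_sub_iff_right, add_le_add_iff_left, mul_le_mul_iff_right₀ hs]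

/-- A flat partition with positive volumes which is stationary for the noise stability has equal
volumes. -/
theorem volumes_eq_of_stationary (hk : 3 ≤ k) (hρ : |ρ| < 1) (hρ0 : ρ ≠ 0)
    (hA : IsGaussianPartition A)
    (hmem : ∀ i x, x ∈ A i ↔ ∀ l, inner ℝ (x - y) (v l) ≤ inner ℝ (x - y) (v i))
    (hpos : ∀ i, 0 < (stdGaussian (EuclideanSpace ℝ (Fin n))).real (A i))
    (hconst : ∀ i j, i ≠ j → ∀ p ∈ A i ∩ A j, ∀ q ∈ A i ∩ A j,
      noiseOperator ρ ((A i).indicator (fun _ => (1 : ℝ))) p -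
        noiseOperator ρ ((A j).indicator (fun _ => (1 : ℝ))) p =
      noiseOperator ρ ((A i).indicator (fun _ => (1 : ℝ))) q -
        noiseOperator ρ ((A j).indicator (fun _ => (1 : ℝ))) q) (i₀ j₀ : Fin k) :
    (stdGaussian (EuclideanSpace ℝ (Fin n))).real (A i₀) =
      (stdGaussian (EuclideanSpace ℝ (Fin n))).real (A j₀) := by
  have hv : ∀ i, ∃ p, ∀ l, l ≠ i → inner ℝ p (v l) < inner ℝ p (v i) := by
    intro i
    obtain ⟨x, hx⟩ := ownPart_nonempty hA (hpos i)
    exact ⟨x - y, (mem_ownPart_iff_of_flat hmem).1 hx⟩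
  -- With only two cones nothing would make both indicators vanish at `-∞`; this is where `3 ≤ k`
  -- enters.
  have hthird : ∀ i j : Fin k, ∃ l, l ≠ i ∧ l ≠ j := by
    intro i j
    have hcard : ({i, j} : Finset (Fin k)).card < Fintype.card (Fin k) := by
      rw [Fintype.card_fin]
      exact (Finset.card_le_two).trans_lt hk
    obtain ⟨l, hl⟩ := Finset.exists_mem_notMem_of_card_lt_card
      (s := {i, j}) (t := Finset.univ) hcard
    exact ⟨l, by simpa using hl.2⟩
  have hedge : ∀ S : Set (Fin k), ∀ i' ∈ S, ∀ j' ∉ S, ∃ i ∈ S, ∃ j ∉ S,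
      noiseOperator ρ ((A i).indicator (fun _ => (1 : ℝ))) y =
        noiseOperator ρ ((A j).indicator (fun _ => (1 : ℝ))) y ∧
      ∫ z, Real.sign (Real.sqrt (1 - ρ ^ 2) * inner ℝ z (v i - v j) -
        (1 - ρ) * inner ℝ y (v i - v j)) ∂(stdGaussian (EuclideanSpace ℝ (Fin n))) = 0 := by
    intro S i' hi' j' hj'
    obtain ⟨i, hi, j, hj, w, hw, hwl⟩ := exists_edge_of_strict_maximizers hv hi' hj'
    exact ⟨i, hi, j, hj, noiseOperator_eq_and_integral_sign_eq_zero_of_edge hρ hρ0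
      hA.measurableSet hmem hw hwl (hthird i j) (hconst i j fun h => hj (h ▸ hi))⟩
  have hy : ∀ i j, inner ℝ y (v i) = inner ℝ y (v j) := by
    have hmax : ∀ i j, inner ℝ y (v i) ≤ inner ℝ y (v j) := by
      by_contra! h
      obtain ⟨i', j', hij'⟩ := h
      -- An edge leaving a superlevel set of `⟨y, v l⟩` joins unequal values, so its half-space
      -- boundary misses the origin and the sign integral cannot vanish.
      obtain ⟨i, hi, j, hj, -, hint⟩ := hedge {l | inner ℝ y (v j') < inner ℝ y (v l)} i' hij' j'
        (fun h => lt_irrefl (inner ℝ y (v j')) h)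
      have hi : inner ℝ y (v j') < inner ℝ y (v i) := hi
      have hj : ¬ inner ℝ y (v j') < inner ℝ y (v j) := hj
      refine integral_sign_inner_sub_ne_zero (mul_pos ?_ ?_) hint
      · linarith [(abs_lt.1 hρ).2]
      · rw [inner_sub_right]
        linarith
    exact fun i j => le_antisymm (hmax i j) (hmax j i)
  by_contra hne
  -- An edge leaving the class of indices with the volume of `A i₀` would join unequal volumes, yet
  -- the values at the apex agree along edges.
  obtain ⟨i, hi, j, hj, heq, -⟩ := hedge
    {l | (stdGaussian (EuclideanSpace ℝ (Fin n))).real (A l) =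
      (stdGaussian (EuclideanSpace ℝ (Fin n))).real (A i₀)} i₀ rfl j₀ fun h => hne h.symm
  rw [volume_eq_noiseOperator_apex hρ hA.measurableSet hmem hy,
    volume_eq_noiseOperator_apex hρ hA.measurableSet hmem hy] at heq
  exact hj (heq.symm.trans hi)

theorem IsGaussianPartition.sum_measureReal (hA : IsGaussianPartition A) :
    ∑ i, (stdGaussian (EuclideanSpace ℝ (Fin n))).real (A i) = 1 := by
  have h := measure_iUnion₀ (μ := stdGaussian (EuclideanSpace ℝ (Fin n))) (f := A)
    (fun i j hij => hA.null_inter i j hij) (fun i => (hA.measurableSet i).nullMeasurableSet)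
  rw [hA.iUnion_eq, measure_univ, tsum_fintype] at h
  simp only [Measure.real]
  rw [← ENNReal.toReal_sum fun i _ => measure_ne_top _ _, ← h, ENNReal.toReal_one]

/-- A flat partition into at least three sets, of positive and not all equal volumes, is neither a
maximizer nor a minimizer of the noise stability. -/
theorem exists_lt_and_exists_gt_of_flat [Nontrivial (EuclideanSpace ℝ (Fin n))] (hk : 3 ≤ k)
    (hρ : |ρ| < 1) (hρ0 : ρ ≠ 0) (hA : IsFlatPartition y A) {a : Fin k → ℝ}
    (hvol : HasVolumes A a) (hpos : ∀ i, 0 < a i) (ha : a ≠ fun _ => 1 / (k : ℝ)) :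
    (∃ s ∈ stabilityValues (n := n) ρ a, noiseStability ρ A < s) ∧
      ∃ s ∈ stabilityValues (n := n) ρ a, s < noiseStability ρ A := by
  obtain ⟨hP, v, -, hmult, hcone⟩ := hA
  have hmem : ∀ i x, x ∈ A i ↔ ∀ l, inner ℝ (x - y) (v l) ≤ inner ℝ (x - y) (v i) := by
    intro i x
    rw [hcone i]
    constructor
    · rintro ⟨x, hx, rfl⟩ l
      simpa using hx l
    · intro h
      exact ⟨x - y, h, by simp⟩
  -- The factor 1 in the condition on positive multiples already makes the vectors distinct.
  have hinj : ∀ i j, i ≠ j → v i ≠ v j := fun i j hij h =>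
    hmult i j hij 1 one_pos (by rw [one_smul, h])
  have hpos' : ∀ i, 0 < (stdGaussian (EuclideanSpace ℝ (Fin n))).real (A i) := fun i => by
    rw [hvol i]; exact hpos i
  by_contra hcon
  have heq := volumes_eq_of_stationary hk hρ hρ0 hP hmem hpos' ?_
  · refine ha (funext fun i => ?_)
    have hsum := hP.sum_measureReal
    rw [Finset.sum_congr rfl fun j _ => heq j i, Finset.sum_const, Finset.card_univ,
      Fintype.card_fin, nsmul_eq_mul, hvol i] at hsum
    have hk0 : (k : ℝ) ≠ 0 := by positivity
    field_simp
    linarith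
  · intro i j hij p hp q hq
    by_contra hne
    refine hcon (exists_lt_and_exists_gt_of_ne hρ hP hij (p := p) (q := q) (fun x => rfl)
      ((continuous_noiseOperator_of_flat hρ hP.measurableSet hmem hinj i).sub
        (continuous_noiseOperator_of_flat hρ hP.measurableSet hmem hinj j)) ?_ ?_ hne hvol)
    · rintro l (rfl | rfl) r hr
      · exact ball_inter_ownPart_pos_of_flat hmem (ownPart_nonempty hP (hpos' _)) hp.1 hr
      · exact ball_inter_ownPart_pos_of_flat hmem (ownPart_nonempty hP (hpos' _)) hp.2 hr
    · rintro l (rfl | rfl) r hr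
      · exact ball_inter_ownPart_pos_of_flat hmem (ownPart_nonempty hP (hpos' _)) hq.1 hr
      · exact ball_inter_ownPart_pos_of_flat hmem (ownPart_nonempty hP (hpos' _)) hq.2 hr

end Flat
end

theorem theorem1 (n : ℕ) (hn : 2 ≤ n)
    (y : EuclideanSpace ℝ (Fin n)) (A : Fin (n + 1) → Set (EuclideanSpace ℝ (Fin n)))
    (hA : IsFlatPartition y A)
    (a : Fin (n + 1) → ℝ) (hvol : HasVolumes A a)
    (hpos : ∀ i, 0 < a i)
    (ha : a ≠ fun _ => 1 / ((n : ℝ) + 1)) :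
    (∀ ρ : ℝ, 0 < ρ → ρ < 1 →
      noiseStability ρ A < sSup (stabilityValues (n := n) ρ a)) ∧
    (∀ ρ : ℝ, -1 < ρ → ρ < 0 →
      noiseStability ρ A > sInf (stabilityValues (n := n) ρ a)) := by
  have : Nonempty (Fin n) := ⟨⟨0, by omega⟩⟩
  have : Nontrivial (EuclideanSpace ℝ (Fin n)) := inferInstance
  have ha' : a ≠ fun _ => 1 / ((n + 1 : ℕ) : ℝ) := by push_cast; exact ha
  constructor
  · intro ρ h0 h1
    obtain ⟨⟨s, hs, hlt⟩, -⟩ := exists_lt_and_exists_gt_of_flat (by omega)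
      (abs_lt.2 ⟨by linarith, h1⟩) h0.ne' hA hvol hpos ha'
    exact hlt.trans_le (le_csSup (stabilityValues_bounded ρ a).1 hs)
  · intro ρ h1 h0
    obtain ⟨-, s, hs, hlt⟩ := exists_lt_and_exists_gt_of_flat (by omega)
      (abs_lt.2 ⟨h1, by linarith⟩) h0.ne hA hvol hpos ha'
    exact (csInf_le (stabilityValues_bounded ρ a).2 hs).trans_lt hlt
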